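/- Let $n\ge 1$ and let $q$ be a prime power. Let $\alpha\in F_q$ be such that $X^2-X-\alpha$ is irreducible over $F_q$, let $w\in F_{q^2}$ with $w^2=w+\alpha$, and put $\xi=2w-1$. Writing each $x\in F_{q^2}$ uniquely as $x=y+wz$ with $y,z\in F_q$, let $$\phi:F_{q^2}^{2n}\to F_q^{4n},\qquad (x_0,\dots,x_{2n-1})\mapsto(y_0,z_0,\dots,y_{2n-1},z_{2n-1})$$ be the field reduction map. Let $J_n$ be the block-diagonal $2n\times 2n$ matrix with $n$ diagonal blocks $\begin{pmatrix}0&\xi\\ \xi^q&0\end{pmatrix}$, let $H(x,x')=xJ_n(x'^q)^T$, and let $GU(2n,q)=\{M\in GL(2n,q^2): M^TJ_nM^q=J_n\}$ and $SU(2n,q)=\{M\in GU(2n,q):\det M=1\}$, where $M^q$ is obtained from $M$ by raising every entry to the power $q$. Let $Q^+(4n-1,q)$ be the hyperbolic quadric of $PG(4n-1,q)$ given by the form $Q(y_0,z_0,\dots,y_{2n-1},z_{2n-1})=-\xi^2\sum_{k=0}^{n-1}(y_{2k}z_{2k+1}-z_{2k}y_{2k+1})$, so that $Q(\phi(x))=H(x,x)$.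 Its generators are its maximal totally singular subspaces. Let $PGO^+(4n,q)$ be the group of projectivities of $PG(4n-1,q)$ stabilizing $Q^+(4n-1,q)$, and let $$\mathcal L_1=\{\phi(\langle x\rangle_{q^2}) : x\ne 0,\ H(x,x)=0\}$$ be the Desarguesian line-spread of $Q^+(4n-1,q)$. Each $M\in GU(2n,q)$ induces, via $\phi(x)\mapsto\phi(xM^T)$, a projectivity of $PG(4n-1,q)$; let $G_n$ and $K_n$ be the groups of projectivities induced in this way by $GU(2n,q)$ and $SU(2n,q)$. Then $G_n\le PGO^+(4n,q)$ and $G_n\cong GU(2n,q)/\langle -I\rangle$. The group $G_n$ has exactly $n+1$ orbits $\mathcal O_{n,0},\dots,\mathcal O_{n,n}$ on the generators of $Q^+(4n-1,q)$, where $$|\mathcal O_{n,0}|=q^{n^2-n}\prod_{j=1}^n(q^{2j-1}+1),\qquad |\mathcal O_{n,n}|=\prod_{j=1}^n(q^{2j-1}+1),$$ $$|\mathcal O_{n,i}|=q^{(n-i)(n-i-1)}\,\frac{\prod_{j=n-i+1}^n(q^{2j}-1)}{\prod_{j=1}^i(q^{2j}-1)}\,\prod_{j=1}^n(q^{2j-1}+1)\qquad(1\le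 i\le n-1),$$ and every member of $\mathcal O_{n,i}$ contains exactly $\frac{q^{2i}-1}{q^2-1}$ lines of $\mathcal L_1$ $(0\le i\le n)$. Moreover, $\mathcal O_{n,i}$ is a single $K_n$-orbit for $1\le i\le n$, whereas $\mathcal O_{n,0}$ splits into exactly $q+1$ orbits of $K_n$, all of the same size. -/

import Mathlib

open scoped Matrix Pointwise

noncomputable section

namespace FieldReduction

/-! ### Projective spaces, projectivities and quadrics

The projective space `PG(V)` is the lattice `Submodule F V`: its points, lines, ... are the
subspaces of vector dimension `1`, `2`, .... -/

section Projective

variable {F V : Type*} [Field F] [AddCommGroup V] [Module F V]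

variable (F V) in
/-- The collineation of `PG(V)` induced by an invertible linear map of `V`. -/
def projectivityHom : (V ≃ₗ[F] V) →* (Submodule F V ≃o Submodule F V) where
  toFun f := Submodule.orderIsoMapComap f
  map_one' := by
    ext W x
    simp
  map_mul' f g := by
    apply RelIso.ext
    intro W
    exact Submodule.map_comp (g : V →ₗ[F] V) (f : V →ₗ[F] V) W

variable (F V) in
/-- The group `PGL(V)` of projectivities of `PG(V)`: the collineations induced by invertible
linear maps. -/
def projectivities : Subgroup (Submodule F V ≃o Submodule F V) :=
  (projectivityHom F V).range

/-- A subspace is totally singular for `Q` if `Q` vanishes on it. -/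
def IsTotallySingular (Q : QuadraticForm F V) (W : Submodule F V) : Prop :=
  ∀ v ∈ W, Q v = 0

/-- The points of the quadric `Q = 0` in `PG(V)`. -/
def quadricPoints (Q : QuadraticForm F V) : Set (Submodule F V) :=
  {P | Module.finrank F P = 1 ∧ IsTotallySingular Q P}

/-- The generators of the quadric `Q = 0`: its maximal totally singular subspaces. -/
def generators (Q : QuadraticForm F V) : Set (Submodule F V) :=
  {W | Maximal (IsTotallySingular Q) W}

/-- The group of projectivities of `PG(V)` that stabilize the quadric `Q = 0`. -/
def projectiveOrthogonalGroup (Q : QuadraticForm F V) :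
    Subgroup (Submodule F V ≃o Submodule F V) :=
  projectivities F V ⊓ MulAction.stabilizer _ (quadricPoints Q)

/-- The set of the orbits, under a group `G` of collineations of `PG(V)`, of the members of a set
`X` of subspaces. -/
def orbitsOn (G : Subgroup (Submodule F V ≃o Submodule F V)) (X : Set (Submodule F V)) :
    Set (Set (Submodule F V)) :=
  (fun W => MulAction.orbit G W) '' X

end Projective

/-! ### The quadratic extension -/

/-- A presentation of the quadratic extension `K = F_{q²}` of `F = F_q`: an element `α` of `F`
such that `X² - X - α` is irreducible over `F`, and a root `w` of that polynomial in `K`. -/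
structure QuadExt (F K : Type*) [Field F] [Field K] [Algebra F K] where
  finrank_eq : Module.finrank F K = 2
  α : F
  irreducible : Irreducible (Polynomial.X ^ 2 - Polynomial.X - Polynomial.C α : Polynomial F)
  w : K
  sq_w : w ^ 2 = w + algebraMap F K α

namespace QuadExt

variable {F K : Type*} [Field F] [Field K] [Algebra F K] (D : QuadExt F K)

theorem smul_one_ne_w (a : F) : a • (1 : K) ≠ D.w := by
  intro h
  have hinj := (algebraMap F K).injective
  have hroot : (Polynomial.X ^ 2 - Polynomial.X - Polynomial.C D.α : Polynomial F).IsRoot a := by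
    have hw := D.sq_w
    rw [← h, Algebra.smul_def, mul_one, ← map_pow, ← map_add] at hw
    have := hinj hw
    simp [Polynomial.IsRoot, this]
  have h1 := Polynomial.degree_eq_one_of_irreducible_of_root D.irreducible hroot
  have h2 : (Polynomial.X ^ 2 - Polynomial.X - Polynomial.C D.α : Polynomial F).degree = 2 := by
    compute_degree!
  rw [h2] at h1
  exact absurd h1 (by decide)

/-- The `F`-basis `(1, w)` of `K`: every element of `K` is uniquely `y + w z` with `y, z ∈ F`. -/
def basis : Module.Basis (Fin 2) F K :=
  basisOfLinearIndependentOfCardEqFinrank (b := ![1, D.w])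
    ((LinearIndependent.pair_iff' one_ne_zero).2 D.smul_one_ne_w)
    (by simp [D.finrank_eq])

@[simp] theorem coe_basis : ⇑D.basis = ![1, D.w] :=
  coe_basisOfLinearIndependentOfCardEqFinrank _ _

/-! ### The spaces `V(2n, q²)` and `V(4n, q)`

The coordinate `x_{2k+j}` of a vector (`0 ≤ k < n`, `j = 0, 1`) has the index `(j, k)`. -/

/-- The index set of the `2n` coordinates. -/
abbrev Idx (n : ℕ) : Type := Fin 2 × Fin n

/-- The `4n`-dimensional space `V(4n, q)`: a vector `v` has the coordinates `y_i = v i 0` and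
`z_i = v i 1`, where `i` runs over the `2n` indices. -/
abbrev V (F : Type*) (n : ℕ) : Type _ := Idx n → Fin 2 → F

/-- The field reduction map `φ : V(2n, q²) → V(4n, q)`, `(x_i) ↦ (y_i, z_i)` where
`x_i = y_i + w z_i`. -/
def φ (n : ℕ) : (Idx n → K) ≃ₗ[F] V F n :=
  LinearEquiv.piCongrRight fun _ => D.basis.equivFun

/-- Field reduction of subspaces. -/
def reduce (n : ℕ) (U : Submodule K (Idx n → K)) : Submodule F (V F n) :=
  (U.restrictScalars F).map (D.φ n : (Idx n → K) →ₗ[F] V F n)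

/-- The `F`-linear bijection of `V(4n, q)` corresponding under `φ` to the map `x ↦ M x` of
`V(2n, q²)` (vectors written as columns). -/
def bar (n : ℕ) : GL (Idx n) K →* (V F n ≃ₗ[F] V F n) where
  toFun M := (D.φ n).symm ≪≫ₗ
    (LinearMap.GeneralLinearGroup.generalLinearEquiv K (Idx n → K)
      (Matrix.GeneralLinearGroup.toLin M)).restrictScalars F ≪≫ₗ D.φ n
  map_one' := by
    ext v
    simp
  map_mul' A B := by
    apply LinearEquiv.ext
    intro v
    simp

theorem bar_φ (n : ℕ) (M : GL (Idx n) K) (x : Idx n → K) :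
    D.bar n M (D.φ n x) = D.φ n ((M : Matrix (Idx n) (Idx n) K) *ᵥ x) := by
  simp [bar, Matrix.GeneralLinearGroup.toLin]

/-! ### The Hermitian form, the unitary groups and the quadric -/

/-- `ξ = 2w - 1`; it satisfies `ξ² = 4α + 1`. -/
def ξ : K := 2 * D.w - 1

theorem ξ_sq : D.ξ ^ 2 = algebraMap F K (4 * D.α + 1) := by
  have := D.sq_w
  simp only [ξ, map_add, map_mul, map_ofNat, map_one]
  linear_combination 4 * this

/-- The hyperbolic quadratic form
`Q(y) = -ξ² ∑_k (y_{2k} z_{2k+1} - z_{2k} y_{2k+1})` on `V(4n, q)`. -/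
def Q (n : ℕ) : QuadraticForm F (V F n) :=
  let c (i : Idx n) (j : Fin 2) : V F n →ₗ[F] F := LinearMap.proj j ∘ₗ LinearMap.proj i
  (-(4 * D.α + 1)) • ∑ k : Fin n,
    (QuadraticMap.linMulLin (c (0, k) 0) (c (1, k) 1)
      - QuadraticMap.linMulLin (c (0, k) 1) (c (1, k) 0))

theorem Q_apply (n : ℕ) (v : V F n) :
    D.Q n v = -(4 * D.α + 1) * ∑ k : Fin n,
      (v (0, k) 0 * v (1, k) 1 - v (0, k) 1 * v (1, k) 0) := by
  simp [Q]

section Unitary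

variable [Fintype F]

/-- The `2n × 2n` matrix `J_n` with diagonal blocks `(0, ξ; ξ^q, 0)`. -/
def J (n : ℕ) : Matrix (Idx n) (Idx n) K :=
  Matrix.blockDiagonal fun _ : Fin n => !![0, D.ξ; D.ξ ^ Fintype.card F, 0]

/-- The Hermitian form `H(x, x') = x J_n (x'^q)ᵀ`. -/
def H (n : ℕ) (x x' : Idx n → K) : K :=
  x ⬝ᵥ (D.J n *ᵥ fun i => x' i ^ Fintype.card F)

theorem w_pow_card : D.w ^ Fintype.card F = 1 - D.w := by
  have hs := D.sq_w
  have h1 : (D.w ^ Fintype.card F) ^ 2 = D.w ^ Fintype.card F + algebraMap F K D.α := by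
    have := congrArg (FiniteField.frobeniusAlgHom F K) hs
    rwa [map_pow, map_add, AlgHom.commutes] at this
  have h2 : (D.w ^ Fintype.card F - D.w) * (D.w ^ Fintype.card F - (1 - D.w)) = 0 := by
    linear_combination h1 - hs
  rcases mul_eq_zero.1 h2 with h | h
  · exfalso
    have : Module.Finite F K := Module.finite_of_finrank_eq_succ D.finrank_eq
    have : Finite K := Module.finite_of_finite F
    have h3 : FiniteField.frobeniusAlgHom F K = 1 := by
      apply AlgHom.toLinearMap_injective
      refine D.basis.ext fun i => ?_
      rw [coe_basis]
      fin_cases i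
      · simp
      · exact sub_eq_zero.1 h
    have h4 := FiniteField.orderOf_frobeniusAlgHom F K
    rw [h3, orderOf_one, D.finrank_eq] at h4
    exact absurd h4 (by decide)
  · exact sub_eq_zero.1 h

/-- Under field reduction `Q` is the form `x ↦ H(x, x)`. -/
theorem Q_φ (n : ℕ) (x : Idx n → K) :
    algebraMap F K (D.Q n (D.φ n x)) = D.H n x x := by
  have hx (i : Idx n) : x i = algebraMap F K (D.φ n x i 0) + D.w * algebraMap F K (D.φ n x i 1) := by
    have := D.basis.sum_equivFun (x i)
    simp only [Fin.sum_univ_two, coe_basis, Algebra.smul_def] at this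
    simpa [φ, mul_comm] using this.symm
  have hq (i : Idx n) : x i ^ Fintype.card F =
      algebraMap F K (D.φ n x i 0) + (1 - D.w) * algebraMap F K (D.φ n x i 1) := by
    have := congrArg (FiniteField.frobeniusAlgHom F K) (hx i)
    rw [map_add, map_mul, AlgHom.commutes, AlgHom.commutes] at this
    simpa only [FiniteField.coe_frobeniusAlgHom, D.w_pow_card] using this
  have hξ : D.ξ ^ Fintype.card F = - D.ξ := by
    have : FiniteField.frobeniusAlgHom F K D.ξ = - D.ξ := by
      simp only [ξ, map_sub, map_mul, map_ofNat, map_one]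
      simp only [FiniteField.coe_frobeniusAlgHom, D.w_pow_card]
      ring
    simpa using this
  rw [Q_apply, H, dotProduct, Fintype.sum_prod_type_right, map_mul, map_neg, ← ξ_sq, map_sum,
    Finset.mul_sum]
  refine Finset.sum_congr rfl fun k _ => ?_
  simp only [Fin.sum_univ_two, Matrix.mulVec, dotProduct, Fintype.sum_prod_type_right, J,
    Matrix.blockDiagonal_apply, hξ, hq, map_sub, map_mul]
  simp
  rw [hx (0, k), hx (1, k)]
  simp only [ξ]
  ring

/-- The unitary group `GU(2n, q)`: the invertible `M` over `K` with `Mᵀ J_n M^q = J_n`, where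
`M^q` is obtained by raising all the entries to the power `q` (the `F`-automorphism of `K`). -/
def GU (n : ℕ) : Subgroup (GL (Idx n) K) where
  carrier := {M | (M : Matrix (Idx n) (Idx n) K)ᵀ * D.J n *
    (M : Matrix (Idx n) (Idx n) K).map (FiniteField.frobeniusAlgHom F K) = D.J n}
  one_mem' := by
    simp [Matrix.map_one]
  mul_mem' := by
    intro A B hA hB
    simp only [Set.mem_ofPred_eq] at hA hB ⊢
    rw [Units.val_mul, Matrix.transpose_mul, Matrix.map_mul]
    calc _ = (B : Matrix (Idx n) (Idx n) K)ᵀ * ((A : Matrix (Idx n) (Idx n) K)ᵀ * D.J n *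
            (A : Matrix (Idx n) (Idx n) K).map (FiniteField.frobeniusAlgHom F K)) *
            (B : Matrix (Idx n) (Idx n) K).map (FiniteField.frobeniusAlgHom F K) := by
          simp only [Matrix.mul_assoc]
      _ = D.J n := by rw [hA, hB]
  inv_mem' := by
    intro A hA
    simp only [Set.mem_ofPred_eq] at hA ⊢
    have h1 : ((A⁻¹ : GL (Idx n) K) : Matrix (Idx n) (Idx n) K)ᵀ *
        (A : Matrix (Idx n) (Idx n) K)ᵀ = 1 := by
      rw [← Matrix.transpose_mul, ← Units.val_mul, mul_inv_cancel]; simp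
    have h2 : (A : Matrix (Idx n) (Idx n) K).map (FiniteField.frobeniusAlgHom F K) *
        ((A⁻¹ : GL (Idx n) K) : Matrix (Idx n) (Idx n) K).map
          (FiniteField.frobeniusAlgHom F K) = 1 := by
      rw [← Matrix.map_mul, ← Units.val_mul, mul_inv_cancel]; simp [Matrix.map_one]
    conv_lhs => rw [← hA]
    simp only [Matrix.mul_assoc]
    rw [h2, ← Matrix.mul_assoc, h1]
    simp

theorem mem_GU (n : ℕ) (M : GL (Idx n) K) :
    M ∈ D.GU n ↔ (M : Matrix (Idx n) (Idx n) K)ᵀ * D.J n *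
      (M : Matrix (Idx n) (Idx n) K).map (fun x => x ^ Fintype.card F) = D.J n :=
  Iff.rfl

/-- The special unitary group `SU(2n, q)`. -/
def SU (n : ℕ) : Subgroup (GL (Idx n) K) :=
  D.GU n ⊓ Matrix.GeneralLinearGroup.det.ker

/-- The subgroup `⟨-I⟩` of `GU(2n, q)`. -/
def negOneSubgroup (n : ℕ) : Subgroup (D.GU n) :=
  (Subgroup.zpowers (-1 : GL (Idx n) K)).subgroupOf (D.GU n)

theorem negOne_mem_GU (n : ℕ) : (-1 : GL (Idx n) K) ∈ D.GU n := by
  rw [mem_GU]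
  have : ((-1 : GL (Idx n) K) : Matrix (Idx n) (Idx n) K).map (fun x => x ^ Fintype.card F)
      = -1 := by
    change ((-1 : GL (Idx n) K) : Matrix (Idx n) (Idx n) K).map
      (FiniteField.frobeniusAlgHom F K) = -1
    rw [Units.val_neg, Units.val_one, Matrix.map_neg _ (map_neg _), Matrix.map_one _ (map_zero _)
      (map_one _)]
  rw [this]
  simp

instance (n : ℕ) : (D.negOneSubgroup n).Normal := by
  refine Subgroup.Normal.subgroupOf ⟨?_⟩ _
  intro x hx g
  obtain ⟨k, rfl⟩ := Subgroup.mem_zpowers_iff.1 hx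
  have hc : Commute g ((-1 : GL (Idx n) K) ^ k) := (Commute.neg_one_right g).zpow_right k
  rw [hc.eq, mul_inv_cancel_right]
  exact hx

/-- The group `G_n` of projectivities of `PG(4n-1, q)` induced by `GU(2n, q)`. -/
def G (n : ℕ) : Subgroup (Submodule F (V F n) ≃o Submodule F (V F n)) :=
  (D.GU n).map ((projectivityHom F (V F n)).comp (D.bar n))

/-- The subgroup `K_n` of `G_n` induced by `SU(2n, q)`. -/
def Kgrp (n : ℕ) : Subgroup (Submodule F (V F n) ≃o Submodule F (V F n)) :=
  (D.SU n).map ((projectivityHom F (V F n)).comp (D.bar n))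

/-- The Desarguesian line-spread `ℒ₁` of the quadric: the lines `φ(⟨x⟩)` of `PG(4n-1, q)` that
come from the points `⟨x⟩` of the Hermitian variety. -/
def L₁ (n : ℕ) : Set (Submodule F (V F n)) :=
  {l | ∃ x : Idx n → K, x ≠ 0 ∧ D.H n x x = 0 ∧ l = D.reduce n (Submodule.span K {x})}

end Unitary

end QuadExt

end FieldReduction

end

noncomputable section

set_option linter.unusedSectionVars false

namespace FieldReduction

namespace QuadExt

/-! ### The conjugation of the quadratic extension -/

section Conj

variable {F K : Type*} [Field F] [Field K] [Algebra F K]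

/-! Everything takes place in the Hermitian space V(2n, q²), with h the form `form`. Through `φ`,
generators of the quadric correspond to maximal totally singular `F`-subspaces W: h(x, x) = 0 on W,
hence h(x, y) + h(y, x) = 0 on W. The elements of trace zero in `K` are exactly ξF
(`add_conj_eq_zero_iff`), so h/ξ is an `F`-valued alternating form on W. Its radical is the largest
`K`-subspace contained in W, the core (`IsMaxSingular.mem_core_iff`): if x and wx both lie in W,
then h(x, y) and w h(x, y) both lie in ξF, which forces h(x, y) = 0. The `K`-dimension i of the core
is the invariant that separates the orbits, and the lines of the spread inside W are the points of
the projective space of the core (`card_lines`).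

Transitivity comes from counting rather than from an extension theorem. Elements of GU(2n, q) are
the same as frames, that is, sequences of n mutually orthogonal hyperbolic pairs (`frameEquiv`). A
matrix maps the standard subspace `std` with i-dimensional core to W exactly when its columns form a
frame adapted to W: i pairs start in the core and the other pairs lie inside W (`moved_std_eq_iff`).
The number of adapted frames is computed by splitting off one hyperbolic pair at a time and depends
only on i and n (`IsMaxSingular.card_adapted`). It is positive, so GU(2n, q) is transitive on the
subspaces with i-dimensional core, and the orbit size is the quotient of the number of all frames
(`card_frames`) by the number of adapted ones.

For SU(2n, q) the determinant decides. It maps GU(2n, q) onto the q + 1 elements of norm one. A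
unitary matrix stabilizing `std` with trivial core has entries in `F` and is symplectic up to
reindexing, so its determinant is 1 (`det_eq_one_of_moved_eq`); the orbit therefore splits according
to the determinant. If i ≥ 1, the stabilizer contains the diagonal matrices with entries a and 1/a^q
on one pair, and by Hilbert 90 their determinants a/a^q are all the elements of norm one, so there
is no splitting. -/

theorem exists_coords (D : QuadExt F K) (x : K) :
    ∃ a b : F, x = algebraMap F K a + algebraMap F K b * D.w := by
  refine ⟨D.basis.equivFun x 0, D.basis.equivFun x 1, ?_⟩
  have := D.basis.sum_equivFun x
  simpa [Fin.sum_univ_two, Algebra.smul_def] using this.symm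

/-- Otherwise 2w = 1, which is absurd in characteristic 2 and puts w = 1/2 into `F` in every other
characteristic. -/
theorem ξ_ne_zero (D : QuadExt F K) : D.ξ ≠ 0 := by
  intro h
  have h2 : (2 : K) * D.w = 1 := sub_eq_zero.1 h
  by_cases h0 : (2 : F) = 0
  · have : (2 : K) = 0 := by rw [← map_ofNat (algebraMap F K), h0, map_zero]
    simp [this] at h2
  · apply D.smul_one_ne_w (1 / 2)
    have h0' : (2 : K) ≠ 0 := by
      intro h; apply h0
      apply (algebraMap F K).injective
      rw [map_ofNat, h, map_zero]
    rw [Algebra.smul_def, mul_one, map_div₀, map_one, map_ofNat]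
    field_simp
    exact h2.symm

variable [Fintype F]

variable (F K) in
/-- The conjugation `x ↦ x ^ q` of `K` over `F`. -/
def conj : K →+* K := (FiniteField.frobeniusAlgHom F K : K →+* K)

theorem conj_apply (x : K) : conj F K x = x ^ Fintype.card F := rfl

@[simp] theorem conj_algebraMap (a : F) : conj F K (algebraMap F K a) = algebraMap F K a :=
  (FiniteField.frobeniusAlgHom F K).commutes a

theorem conj_w (D : QuadExt F K) : conj F K D.w = 1 - D.w := D.w_pow_card

theorem conj_conj (D : QuadExt F K) (x : K) : conj F K (conj F K x) = x := by
  obtain ⟨a, b, rfl⟩ := D.exists_coords x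
  simp [D.conj_w]

theorem conj_ξ (D : QuadExt F K) : conj F K D.ξ = -D.ξ := by
  simp only [ξ, map_sub, map_mul, map_ofNat, map_one, D.conj_w]
  ring

theorem conj_eq_self_iff (D : QuadExt F K) (x : K) :
    conj F K x = x ↔ ∃ a : F, algebraMap F K a = x := by
  constructor
  · intro h
    obtain ⟨a, b, rfl⟩ := D.exists_coords x
    simp only [map_add, map_mul, conj_algebraMap, D.conj_w] at h
    have h1 : algebraMap F K b * D.ξ = 0 := by
      simp only [ξ]; linear_combination -h
    have h2 := (mul_eq_zero.1 h1).resolve_right D.ξ_ne_zero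
    exact ⟨a, by rw [h2]; simp⟩
  · rintro ⟨a, rfl⟩
    simp

/-- Since ξ^q = -ξ, division by ξ turns trace zero into invariance under conjugation. This is
uniform in the characteristic; in characteristic 2 simply ξ = 1. -/
theorem add_conj_eq_zero_iff (D : QuadExt F K) (x : K) :
    x + conj F K x = 0 ↔ ∃ a : F, algebraMap F K a * D.ξ = x := by
  have hξ := D.ξ_ne_zero
  constructor
  · intro h
    obtain ⟨a, ha⟩ := (D.conj_eq_self_iff (x / D.ξ)).1 (by
      rw [map_div₀, D.conj_ξ, eq_neg_of_add_eq_zero_right h, neg_div_neg_eq])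
    exact ⟨a, by rw [ha]; field_simp⟩
  · rintro ⟨a, rfl⟩
    simp [D.conj_ξ]

theorem finite_ext (D : QuadExt F K) : Finite K :=
  have : Module.Finite F K := Module.finite_of_finrank_eq_succ D.finrank_eq
  Module.finite_of_finite F

theorem card_ext (D : QuadExt F K) : Nat.card K = Fintype.card F ^ 2 := by
  have : Module.Finite F K := Module.finite_of_finrank_eq_succ D.finrank_eq
  have := Module.natCard_eq_pow_finrank (K := F) (V := K)
  rwa [D.finrank_eq, Nat.card_eq_fintype_card (α := F)] at this

theorem algebraMap_norm (D : QuadExt F K) (c : K) :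
    algebraMap F K (Algebra.norm F c) = c * conj F K c := by
  have := D.finite_ext
  have h1 : 1 < Fintype.card F := Fintype.one_lt_card
  rw [FiniteField.algebraMap_norm_eq_pow, D.card_ext, Nat.card_eq_fintype_card (α := F),
    conj_apply, ← pow_succ']
  congr 1
  have : Fintype.card F ^ 2 - 1 = (Fintype.card F + 1) * (Fintype.card F - 1) := by
    zify [h1.le, Nat.one_le_pow 2 _ (Nat.zero_lt_of_lt h1)]; ring
  rw [this, Nat.mul_div_cancel _ (by omega)]

theorem mul_conj_surjective (D : QuadExt F K) (a : F) :
    ∃ c : K, c * conj F K c = algebraMap F K a := by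
  have := D.finite_ext
  obtain ⟨c, rfl⟩ := FiniteField.norm_surjective F K a
  exact ⟨c, (D.algebraMap_norm c).symm⟩

/-- Hilbert 90 for the quadratic extension. -/
theorem exists_div_conj_eq (D : QuadExt F K) (d : K) (hd : d * conj F K d = 1) :
    ∃ a : K, a ≠ 0 ∧ a / conj F K a = d := by
  by_cases h : d = -1
  · refine ⟨D.ξ, D.ξ_ne_zero, ?_⟩
    rw [D.conj_ξ, h, div_neg, div_self D.ξ_ne_zero]
  · have h1 : 1 + d ≠ 0 := fun h' => h (eq_neg_of_add_eq_zero_right h')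
    -- With d d^q = 1, one has d (1 + d)^q = d + 1. This fails to give a non-zero a only for d = -1,
    -- where ξ serves.
    refine ⟨1 + d, h1, ?_⟩
    rw [div_eq_iff ((map_ne_zero _).2 h1)]
    simp only [map_add, map_one]
    linear_combination -hd

/-- There are `q + 1` elements of norm one. -/
theorem card_norm_one (D : QuadExt F K) :
    Nat.card {d : K // d * conj F K d = 1} = Fintype.card F + 1 := by
  have := D.finite_ext
  have h1 : 1 < Fintype.card F := Fintype.one_lt_card
  let N : Kˣ →* Fˣ := Units.map (Algebra.norm F)
  -- The norm is onto, so its kernel has order (q² - 1)/(q - 1).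
  have hker : Nat.card N.ker * Nat.card Fˣ = Nat.card Kˣ := by
    have h := Subgroup.card_eq_card_quotient_mul_card_subgroup N.ker
    rw [h, mul_comm, Nat.card_congr (QuotientGroup.quotientKerEquivOfSurjective N
      (FiniteField.unitsMap_norm_surjective F K)).toEquiv]
  have he : Nat.card {d : K // d * conj F K d = 1} = Nat.card N.ker := by
    symm
    refine Nat.card_congr (Equiv.ofBijective (fun u => ⟨u.1, ?_⟩) ⟨?_, ?_⟩)
    · rw [← D.algebraMap_norm]
      have := u.2
      rw [MonoidHom.mem_ker, Units.ext_iff] at this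
      change Algebra.norm F ((u : Kˣ) : K) = 1 at this
      rw [this, map_one]
    · intro u v huv
      exact Subtype.ext (Units.ext (congrArg Subtype.val huv))
    · rintro ⟨d, hd⟩
      refine ⟨⟨Units.mkOfMulEqOne d _ hd, ?_⟩, rfl⟩
      rw [MonoidHom.mem_ker, Units.ext_iff]
      change Algebra.norm F d = 1
      apply (algebraMap F K).injective
      rw [D.algebraMap_norm, hd, map_one]
  rw [he]
  rw [Nat.card_units, Nat.card_units, D.card_ext, Nat.card_eq_fintype_card (α := F)] at hker
  apply Nat.eq_of_mul_eq_mul_right (show 0 < Fintype.card F - 1 by omega)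
  rw [hker]
  zify [h1.le, Nat.one_le_pow 2 _ (Nat.zero_lt_of_lt h1)]; ring

end Conj

/-! ### Hyperbolic pairs in a Hermitian space -/

section Hermitian

variable {F K : Type*} [Field F] [Fintype F] [Field K] [Algebra F K] {D : QuadExt F K}
  {X : Type*} [AddCommGroup X] [Module K X] {h : X →ₗ[K] X →ₛₗ[conj F K] K}

/-- The form `h` is Hermitian. -/
def IsHermitianForm (h : X →ₗ[K] X →ₛₗ[conj F K] K) : Prop :=
  ∀ x y, conj F K (h x y) = h y x

/-- The form `h` is non-degenerate on the subspace `Y`. -/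
def NondegOn (h : X →ₗ[K] X →ₛₗ[conj F K] K) (Y : Submodule K X) : Prop :=
  ∀ y ∈ Y, (∀ z ∈ Y, h y z = 0) → y = 0

/-- A hyperbolic pair: two isotropic vectors `e`, `f` with `h e f = ξ`. -/
def IsHypPair (D : QuadExt F K) (h : X →ₗ[K] X →ₛₗ[conj F K] K) (p : X × X) : Prop :=
  h p.1 p.1 = 0 ∧ h p.2 p.2 = 0 ∧ h p.1 p.2 = D.ξ

/-- The orthogonal complement of a pair of vectors. -/
def orth (h : X →ₗ[K] X →ₛₗ[conj F K] K) (p : X × X) : Submodule K X :=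
  LinearMap.ker (h.flip p.1) ⊓ LinearMap.ker (h.flip p.2)

theorem mem_orth {p : X × X} {x : X} : x ∈ orth h p ↔ h x p.1 = 0 ∧ h x p.2 = 0 := by
  simp [orth]

theorem IsHermitianForm.eq_zero_comm (hh : IsHermitianForm h) {x y : X} :
    h x y = 0 ↔ h y x = 0 := by
  rw [← hh x y, map_eq_zero (conj F K)]

theorem IsHermitianForm.mem_orth_symm (hh : IsHermitianForm h) {p r : X × X}
    (h1 : r.1 ∈ orth h p) (h2 : r.2 ∈ orth h p) : p.1 ∈ orth h r ∧ p.2 ∈ orth h r := by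
  rw [mem_orth] at h1 h2
  rw [mem_orth, mem_orth]
  exact ⟨⟨hh.eq_zero_comm.1 h1.1, hh.eq_zero_comm.1 h2.1⟩,
    ⟨hh.eq_zero_comm.1 h1.2, hh.eq_zero_comm.1 h2.2⟩⟩

theorem IsHypPair.flip_eq (hh : IsHermitianForm h) {p : X × X} (hp : IsHypPair D h p) :
    h p.2 p.1 = -D.ξ := by
  rw [← hh, hp.2.2, D.conj_ξ]

/-- The first coordinate of a vector with respect to a hyperbolic pair. -/
def coeffL (D : QuadExt F K) (h : X →ₗ[K] X →ₛₗ[conj F K] K) (p : X × X) (x : X) : K :=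
  h x p.2 / D.ξ

/-- The second coordinate of a vector with respect to a hyperbolic pair. -/
def coeffR (D : QuadExt F K) (h : X →ₗ[K] X →ₛₗ[conj F K] K) (p : X × X) (x : X) : K :=
  -(h x p.1 / D.ξ)

/-- The projection of a vector to the orthogonal complement of a hyperbolic pair. -/
def projOrth (D : QuadExt F K) (h : X →ₗ[K] X →ₛₗ[conj F K] K) (p : X × X) (x : X) : X :=
  x - coeffL D h p x • p.1 - coeffR D h p x • p.2

theorem coeff_add_projOrth (p : X × X) (x : X) :
    coeffL D h p x • p.1 + coeffR D h p x • p.2 + projOrth D h p x = x := by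
  simp only [projOrth]; abel

theorem projOrth_mem (hh : IsHermitianForm h) {p : X × X} (hp : IsHypPair D h p) (x : X) :
    projOrth D h p x ∈ orth h p := by
  have hξ := D.ξ_ne_zero
  rw [mem_orth]
  simp only [projOrth, map_sub, map_smul, LinearMap.sub_apply, LinearMap.smul_apply, smul_eq_mul,
    hp.1, hp.2.1, hp.2.2, hp.flip_eq hh, coeffL, coeffR]
  constructor <;> field_simp <;> ring

/-! ### Coordinates with respect to a hyperbolic pair. -/

section Coord

variable {p : X × X} {y : X} (a b : K)

theorem form_fst (hh : IsHermitianForm h) (hp : IsHypPair D h p) (hy : y ∈ orth h p) :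
    h (a • p.1 + b • p.2 + y) p.1 = -(b * D.ξ) := by
  rw [mem_orth] at hy
  simp [hp.1, hp.flip_eq hh, hy.1]

theorem form_snd (hp : IsHypPair D h p) (hy : y ∈ orth h p) :
    h (a • p.1 + b • p.2 + y) p.2 = a * D.ξ := by
  rw [mem_orth] at hy
  simp [hp.2.1, hp.2.2, hy.2]

theorem form_orth (hh : IsHermitianForm h) {z : X} (hz : z ∈ orth h p) :
    h (a • p.1 + b • p.2 + y) z = h y z := by
  rw [mem_orth] at hz
  simp [hh.eq_zero_comm.1 hz.1, hh.eq_zero_comm.1 hz.2]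

theorem form_self (hh : IsHermitianForm h) (hp : IsHypPair D h p) (hy : y ∈ orth h p) :
    h (a • p.1 + b • p.2 + y) (a • p.1 + b • p.2 + y) =
      a * conj F K b * D.ξ + conj F K (a * conj F K b * D.ξ) + h y y := by
  have e1 := form_fst a b hh hp hy
  have e2 := form_snd a b hp hy
  have e3 := form_orth (y := y) a b hh hy
  rw [(h _).map_add, (h _).map_add, (h _).map_smulₛₗ, (h _).map_smulₛₗ, e1, e2, e3]
  simp only [map_mul, D.conj_ξ, D.conj_conj, smul_eq_mul]
  ring

theorem coord_inj (hh : IsHermitianForm h) (hp : IsHypPair D h p) {a b a' b' : K} {y y' : X}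
    (hy : y ∈ orth h p) (hy' : y' ∈ orth h p)
    (he : a • p.1 + b • p.2 + y = a' • p.1 + b' • p.2 + y') : a = a' ∧ b = b' ∧ y = y' := by
  have hξ := D.ξ_ne_zero
  have ha : a = a' := by
    have := congrArg (fun x => h x p.2) he
    simp only [form_snd _ _ hp hy, form_snd _ _ hp hy'] at this
    exact mul_right_cancel₀ hξ this
  have hb : b = b' := by
    have := congrArg (fun x => h x p.1) he
    simp only [form_fst _ _ hh hp hy, form_fst _ _ hh hp hy', neg_inj] at this
    exact mul_right_cancel₀ hξ this
  subst ha hb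
  exact ⟨rfl, rfl, add_left_cancel he⟩

end Coord

/-- Counting a set of vectors that is a product with respect to the decomposition defined by a
hyperbolic pair. -/
theorem card_eq_of_split (hh : IsHermitianForm h) {p : X × X} (hp : IsHypPair D h p) (S S' : Set X)
    (A B : Set K) (hS : ∀ a b y, y ∈ orth h p →
      (a • p.1 + b • p.2 + y ∈ S ↔ a ∈ A ∧ b ∈ B ∧ y ∈ S')) (hS' : ∀ y ∈ S', y ∈ orth h p) :
    Nat.card S = Nat.card A * Nat.card B * Nat.card S' := by
  rw [← Nat.card_prod, ← Nat.card_prod]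
  symm
  refine Nat.card_congr (Equiv.ofBijective
    (fun t => ⟨(t.1.1 : K) • p.1 + (t.1.2 : K) • p.2 + t.2,
      (hS _ _ _ (hS' _ t.2.2)).2 ⟨t.1.1.2, t.1.2.2, t.2.2⟩⟩) ⟨?_, ?_⟩)
  · rintro ⟨⟨a, b⟩, y⟩ ⟨⟨a', b'⟩, y'⟩ he
    obtain ⟨h1, h2, h3⟩ := coord_inj hh hp (hS' _ y.2) (hS' _ y'.2) (congrArg Subtype.val he)
    exact Prod.ext (Prod.ext (Subtype.ext h1) (Subtype.ext h2)) (Subtype.ext h3)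
  · rintro ⟨x, hx⟩
    have hx' := hx
    rw [← coeff_add_projOrth (D := D) (h := h) p x, hS _ _ _ (projOrth_mem hh hp x)] at hx'
    exact ⟨⟨⟨⟨_, hx'.1⟩, ⟨_, hx'.2.1⟩⟩, ⟨_, hx'.2.2⟩⟩, Subtype.ext (coeff_add_projOrth p x)⟩

/-- The ring of scalars is arbitrary because this serves both `K`-subspaces and `F`-subspaces. -/
theorem IsHypPair.smul_add_mem_iff {R : Type*} [Ring R] [Module R X] {p : X × X} {Y : Submodule R X}
    {a b : R} (h1 : p.1 ∈ Y) (h2 : p.2 ∈ Y) {y : X} :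
    a • p.1 + b • p.2 + y ∈ Y ↔ y ∈ Y :=
  Y.add_mem_iff_right (Y.add_mem (Y.smul_mem _ h1) (Y.smul_mem _ h2))

theorem card_inf_orth (hh : IsHermitianForm h) {p : X × X} (hp : IsHypPair D h p)
    {Y : Submodule K X} (h1 : p.1 ∈ Y) (h2 : p.2 ∈ Y) :
    Nat.card Y = Fintype.card F ^ 4 * Nat.card (Y ⊓ orth h p : Submodule K X) := by
  have := card_eq_of_split hh hp (Y : Set X) (Y ⊓ orth h p : Submodule K X) Set.univ Set.univ
    (fun a b y hy => by
      simp [IsHypPair.smul_add_mem_iff h1 h2, hy]) (fun y hy => hy.2)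
  rw [Nat.card_univ, D.card_ext, ← pow_add] at this
  exact this

/-- A vector of the radical of the smaller space is also orthogonal to the pair, hence to all of
`Y`. With `card_inf_orth` this drives all inductions on the dimension. -/
theorem NondegOn.inf_orth (hh : IsHermitianForm h) {p : X × X} (hp : IsHypPair D h p)
    {Y : Submodule K X} (hY : NondegOn h Y) (h1 : p.1 ∈ Y) (h2 : p.2 ∈ Y) :
    NondegOn h (Y ⊓ orth h p) := by
  intro y hy hz
  refine hY y hy.1 fun z hzY => ?_
  have hmem := projOrth_mem hh hp z
  rw [← coeff_add_projOrth (D := D) (h := h) p z] at hzY ⊢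
  rw [hh.eq_zero_comm, form_orth _ _ hh hy.2, hh.eq_zero_comm]
  exact hz _ ⟨(IsHypPair.smul_add_mem_iff h1 h2).1 hzY, hmem⟩

/-- An isotropic vector that is not in the radical belongs to a hyperbolic pair. -/
theorem NondegOn.exists_partner (hh : IsHermitianForm h) {Y : Submodule K X} (hY : NondegOn h Y)
    {e : X} (he : e ∈ Y) (he0 : e ≠ 0) (hee : h e e = 0) :
    ∃ f ∈ Y, IsHypPair D h (e, f) := by
  have hξ := D.ξ_ne_zero
  obtain ⟨z, hz, hez⟩ : ∃ z ∈ Y, h e z ≠ 0 := by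
    by_contra! hc
    exact he0 (hY e he hc)
  obtain ⟨c, hc⟩ : ∃ c : K, conj F K c * h e z = D.ξ :=
    ⟨conj F K (D.ξ / h e z), by rw [D.conj_conj]; field_simp⟩
  set z' := c • z with hz'
  have hez' : h e z' = D.ξ := by rw [hz', (h e).map_smulₛₗ]; exact hc
  have hze' : h z' e = -D.ξ := by rw [← hh, hez', D.conj_ξ]
  have hzz : conj F K (h z' z') = h z' z' := hh _ _
  -- Adding a multiple of e keeps the product with e and changes the norm of z' by a trace. As w has
  -- trace 1, it replaces one half and the correction works in every characteristic.
  refine ⟨z' + (-(D.w * h z' z' / D.ξ)) • e, Y.add_mem (Y.smul_mem _ hz) (Y.smul_mem _ he), hee,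
    ?_, ?_⟩
  · simp only [map_add, LinearMap.add_apply, map_smul, LinearMap.smul_apply, smul_eq_mul,
      LinearMap.map_smulₛₗ, hee, hez', hze', map_neg, map_mul, map_div₀, hzz, D.conj_ξ, D.conj_w]
    field_simp
    ring
  · simp only [map_add, LinearMap.map_smulₛₗ, hee, hez', smul_zero, add_zero]

theorem exists_isotropic [Finite X] (hh : IsHermitianForm h) {Y : Submodule K X}
    (hc : Fintype.card F ^ 2 < Nat.card Y) (D : QuadExt F K) :
    ∃ e ∈ Y, e ≠ 0 ∧ h e e = 0 := by
  by_contra! hno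
  have : Finite K := D.finite_ext
  have h1 : 1 < Nat.card Y := lt_of_le_of_lt (Nat.one_le_pow _ _ Fintype.card_pos) hc
  obtain ⟨y₁, hy₁⟩ : ∃ y : Y, y ≠ 0 := by
    have := (Finite.one_lt_card_iff_nontrivial (α := Y)).1 h1
    exact exists_ne 0
  -- `Y` has more than q² = |K| elements, so the functional h(·, y₁) has a non-zero kernel; this
  -- supplies a vector orthogonal to y₁.
  have hni : ¬ Function.Injective fun y : Y => h y y₁ := by
    intro hinj
    have := Nat.card_le_card_of_injective _ hinj
    rw [D.card_ext] at this
    omega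
  obtain ⟨y₂, hy₂, hy₂0, horth⟩ : ∃ y ∈ Y, y ≠ 0 ∧ h y y₁ = 0 := by
    simp only [Function.Injective] at hni
    push Not at hni
    obtain ⟨a, b, hab, hne⟩ := hni
    exact ⟨a - b, Y.sub_mem a.2 b.2, fun h0 => hne (Subtype.ext (sub_eq_zero.1 h0)), by
      rw [map_sub, LinearMap.sub_apply, hab, sub_self]⟩
  have ha := hno y₁ y₁.2 (fun h0 => hy₁ (Subtype.ext h0))
  have hb := hno y₂ hy₂ hy₂0
  obtain ⟨a, ha'⟩ := (D.conj_eq_self_iff _).1 (hh y₁ y₁)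
  obtain ⟨b, hb'⟩ := (D.conj_eq_self_iff _).1 (hh y₂ y₂)
  have ha0 : a ≠ 0 := by rintro rfl; exact ha (by rw [← ha', map_zero])
  -- On c y₁ + y₂ the form takes the value N(c) a + b, and the norm N is surjective.
  obtain ⟨c, hc⟩ := D.mul_conj_surjective (-(b / a))
  have horth' : h y₁ y₂ = 0 := hh.eq_zero_comm.1 horth
  refine hno (c • (y₁ : X) + y₂) (Y.add_mem (Y.smul_mem _ y₁.2) hy₂) (fun h0 => hb ?_) ?_
  · have := congrArg (fun x => h x y₂) h0
    simpa [horth'] using this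
  · simp only [map_add, LinearMap.add_apply, map_smul, LinearMap.smul_apply, smul_eq_mul,
      LinearMap.map_smulₛₗ, horth, horth', ← ha', ← hb', mul_zero, add_zero, zero_add]
    rw [← mul_assoc, mul_comm (conj F K c), hc, ← map_mul, ← map_add]
    rw [show -(b / a) * a + b = 0 by field_simp; ring, map_zero]

/-- The isotropic vectors of `Y` with a given non-zero product with `e`. -/
theorem card_isotropic_of_ne_zero (hh : IsHermitianForm h) {p : X × X} (hp : IsHypPair D h p)
    {Y : Submodule K X} (h1 : p.1 ∈ Y) (h2 : p.2 ∈ Y) {b : K} (hb : b ≠ 0) :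
    Nat.card {x : X // x ∈ Y ∧ h x x = 0 ∧ coeffR D h p x = b} =
      Fintype.card F * Nat.card (Y ⊓ orth h p : Submodule K X) := by
  have hξ := D.ξ_ne_zero
  have hcb : conj F K b ≠ 0 := (map_ne_zero _).2 hb
  rw [Fintype.card_eq_nat_card, ← Nat.card_prod]
  symm
  -- The vector a e + b f + y is isotropic when a b^q ξ has trace -h(y, y). One solution is -w h(y,
  -- y), because w has trace 1; the others differ from it by the elements tξ of trace zero. Thus
  -- each y gives exactly q values of a.
  have key : ∀ (t : F) (y : X), (algebraMap F K t * D.ξ - D.w * h y y) / (conj F K b * D.ξ) *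
      conj F K b * D.ξ = algebraMap F K t * D.ξ - D.w * h y y := fun t y => by field_simp
  have hb' : ∀ (a : K) (y : X), y ∈ orth h p → coeffR D h p (a • p.1 + b • p.2 + y) = b :=
    fun a y hy => by rw [coeffR, form_fst _ _ hh hp hy]; field_simp
  refine Nat.card_congr (Equiv.ofBijective (fun t => ⟨
      ((algebraMap F K t.1 * D.ξ - D.w * h (t.2 : X) (t.2 : X)) / (conj F K b * D.ξ)) • p.1
        + b • p.2 + (t.2 : X), ?_, ?_, ?_⟩) ⟨?_, ?_⟩)
  · exact (IsHypPair.smul_add_mem_iff h1 h2).2 t.2.2.1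
  · rw [form_self _ _ hh hp t.2.2.2, key]
    simp only [map_sub, map_mul, conj_algebraMap, D.conj_ξ, D.conj_w, hh _ _]
    ring
  · exact hb' _ _ t.2.2.2
  · rintro ⟨t, y⟩ ⟨t', y'⟩ he
    obtain ⟨e1, -, e3⟩ := coord_inj hh hp y.2.2 y'.2.2 (congrArg Subtype.val he)
    have e3' : y = y' := Subtype.ext e3
    subst e3'
    refine Prod.ext ?_ rfl
    have e4 := congrArg (fun c => c * conj F K b * D.ξ) e1
    simp only [key] at e4
    exact (algebraMap F K).injective (mul_right_cancel₀ hξ (sub_left_injective e4))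
  · rintro ⟨x, hxY, hxx, hxb⟩
    have hmem := projOrth_mem hh hp x
    have hdec := coeff_add_projOrth (D := D) (h := h) p x
    rw [hxb] at hdec
    set a := coeffL D h p x
    set y := projOrth D h p x
    have hyY : y ∈ Y := by
      rw [← hdec] at hxY
      exact (IsHypPair.smul_add_mem_iff h1 h2).1 hxY
    have hself := form_self a b hh hp hmem
    rw [hdec, hxx] at hself
    obtain ⟨t, ht⟩ := (D.add_conj_eq_zero_iff (a * conj F K b * D.ξ + D.w * h y y)).1 (by
      rw [map_add, map_mul (conj F K) D.w, hh, D.conj_w]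
      linear_combination -hself)
    refine ⟨⟨t, ⟨y, hyY, hmem⟩⟩, Subtype.ext ?_⟩
    change _ • p.1 + b • p.2 + y = x
    rw [ht, add_sub_cancel_right, mul_assoc, mul_div_cancel_right₀ _ (mul_ne_zero hcb hξ)]
    exact hdec

/-- With b = 0 the coefficient of e drops out of the norm, so it is free, and only the component in
the orthogonal complement has to be isotropic. -/
theorem card_isotropic_zero (hh : IsHermitianForm h) {p : X × X} (hp : IsHypPair D h p)
    {Y : Submodule K X} (h1 : p.1 ∈ Y) (h2 : p.2 ∈ Y) :
    Nat.card {x : X // x ∈ Y ∧ h x x = 0 ∧ coeffR D h p x = 0} =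
      Fintype.card F ^ 2 * Nat.card {x : X // x ∈ Y ⊓ orth h p ∧ h x x = 0} := by
  have hξ := D.ξ_ne_zero
  have := card_eq_of_split hh hp {x | x ∈ Y ∧ h x x = 0 ∧ coeffR D h p x = 0}
    {x | x ∈ Y ⊓ orth h p ∧ h x x = 0} Set.univ {0} (fun a b y hy => ?_) (fun y hy => hy.1.2)
  · rw [Nat.card_univ, D.card_ext, Nat.card_unique (α := ({0} : Set K)), mul_one] at this
    exact this
  · have hc : coeffR D h p (a • p.1 + b • p.2 + y) = b := by
      rw [coeffR, form_fst _ _ hh hp hy]; field_simp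
    simp only [Set.mem_ofPred_eq, hc, IsHypPair.smul_add_mem_iff h1 h2, Set.mem_univ, true_and,
      Set.mem_singleton_iff, Submodule.mem_inf, hy, and_true]
    constructor
    · rintro ⟨hyY, hyy, rfl⟩
      rw [form_self _ _ hh hp hy] at hyy
      exact ⟨rfl, hyY, by simpa using hyy⟩
    · rintro ⟨rfl, hyY, hyy⟩
      exact ⟨hyY, by rw [form_self _ _ hh hp hy]; simpa using hyy, rfl⟩

/-- The second members of the hyperbolic pairs with a given first member. -/
theorem NondegOn.card_partners (hh : IsHermitianForm h) {Y : Submodule K X} (hY : NondegOn h Y)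
    {e : X} (he : e ∈ Y) (he0 : e ≠ 0) (hee : h e e = 0) {m : ℕ}
    (hc : Nat.card Y = Fintype.card F ^ (4 * (m + 1))) :
    Nat.card {f : X // f ∈ Y ∧ IsHypPair D h (e, f)} = Fintype.card F ^ (4 * m + 1) := by
  have hξ := D.ξ_ne_zero
  obtain ⟨f₀, hf₀, hp⟩ := hY.exists_partner (D := D) hh he he0 hee
  have hq : 0 < Fintype.card F := Fintype.card_pos
  -- Relative to one fixed partner f₀, the partners of e are the isotropic vectors whose
  -- f₀-coefficient equals 1.
  have h1 := card_isotropic_of_ne_zero hh hp he hf₀ one_ne_zero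
  have h2 := card_inf_orth hh hp he hf₀
  rw [hc, show 4 * (m + 1) = 4 + 4 * m by ring, pow_add] at h2
  rw [← Nat.eq_of_mul_eq_mul_left (by positivity) h2, ← pow_succ'] at h1
  rw [← h1]
  refine Nat.card_congr (Equiv.subtypeEquivRight fun f => ?_)
  refine and_congr_right fun _ => ?_
  simp only [IsHypPair, hee, true_and]
  refine and_congr_right fun _ => ?_
  rw [coeffR, neg_eq_iff_eq_neg, div_eq_iff hξ, ← hh e f, neg_one_mul]
  constructor
  · intro h'; rw [h', D.conj_ξ]
  · intro h'
    rw [← D.conj_conj (h e f), h', map_neg, D.conj_ξ, neg_neg]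

/-- The number of isotropic vectors. -/
theorem NondegOn.card_isotropic [Finite X] (hh : IsHermitianForm h) (D : QuadExt F K) :
    ∀ (m : ℕ) (Y : Submodule K X), NondegOn h Y → Nat.card Y = Fintype.card F ^ (4 * m) →
      Nat.card {x : X // x ∈ Y ∧ h x x = 0} * Fintype.card F + Fintype.card F ^ (2 * m) =
        Fintype.card F ^ (4 * m) + Fintype.card F ^ (2 * m + 1)
  | 0, Y, _, hc => by
    have hbot : Y = ⊥ := by
      rw [mul_zero, pow_zero, Nat.card_eq_one_iff_unique] at hc
      obtain ⟨hs, _⟩ := hc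
      exact (Submodule.subsingleton_iff_eq_bot).1 hs
    subst hbot
    have : Nat.card {x : X // x ∈ (⊥ : Submodule K X) ∧ h x x = 0} = 1 := by
      rw [Nat.card_eq_one_iff_unique]
      exact ⟨⟨fun a b => Subtype.ext (((Submodule.mem_bot K).1 a.2.1).trans
        ((Submodule.mem_bot K).1 b.2.1).symm)⟩, ⟨⟨0, by simp⟩⟩⟩
    rw [this]
    ring
  | m + 1, Y, hY, hc => by
    have : Finite K := D.finite_ext
    have : Fintype K := Fintype.ofFinite K
    classical
    have hq : 1 < Fintype.card F := Fintype.one_lt_card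
    obtain ⟨e, he, he0, hee⟩ := exists_isotropic (Y := Y) hh
      (by rw [hc]; exact Nat.pow_lt_pow_right hq (by omega)) D
    obtain ⟨f, hf, hp⟩ := hY.exists_partner (D := D) hh he he0 hee
    have hc' := card_inf_orth hh hp he hf
    rw [hc, show 4 * (m + 1) = 4 + 4 * m by ring, pow_add] at hc'
    have hc'' := (Nat.eq_of_mul_eq_mul_left (by positivity) hc').symm
    have ih := NondegOn.card_isotropic hh D m _ (hY.inf_orth hh hp he hf) hc''
    -- Sort the isotropic vectors by their f-coefficient b. The value b = 0 contributes q² times the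
    -- count in the complement, and each of the q² - 1 other values contributes q · q^(4m).
    have hsum : Nat.card {x : X // x ∈ Y ∧ h x x = 0} =
        ∑ b : K, Nat.card {x : X // x ∈ Y ∧ h x x = 0 ∧ coeffR D h (e, f) x = b} := by
      rw [← Nat.card_sigma]
      refine Nat.card_congr ⟨fun x => ⟨coeffR D h (e, f) x, x, x.2.1, x.2.2, rfl⟩,
        fun s => ⟨s.2, s.2.2.1, s.2.2.2.1⟩, fun x => rfl, ?_⟩
      rintro ⟨b, x, h1, h2, rfl⟩
      rfl
    rw [← Finset.add_sum_erase _ _ (Finset.mem_univ (0 : K)), card_isotropic_zero hh hp he hf,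
      Finset.sum_congr rfl (fun b hb => card_isotropic_of_ne_zero hh hp he hf
        (Finset.ne_of_mem_erase hb)), Finset.sum_const, smul_eq_mul,
      Finset.card_erase_of_mem (Finset.mem_univ _), Finset.card_univ, Fintype.card_eq_nat_card (α := K),
      D.card_ext, hc''] at hsum
    rw [hsum]
    have h2 : 1 ≤ Fintype.card F ^ 2 := Nat.one_le_pow _ _ (by omega)
    zify [h2] at ih ⊢
    generalize (Nat.card {x : X // x ∈ Y ⊓ orth h (e, f) ∧ h x x = 0} : ℤ) = z at ih ⊢
    generalize (Fintype.card F : ℤ) = q at ih ⊢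
    rw [show 4 * (m + 1) = 4 * m + 4 by ring, show 2 * (m + 1) + 1 = 2 * m + 3 by ring,
      show 2 * (m + 1) = 2 * m + 2 by ring]
    simp only [pow_add _ (4 * m), pow_add _ (2 * m)] at ih ⊢
    linear_combination q ^ 2 * ih

end Hermitian

/-! ### Counting hyperbolic frames -/

section Frames

variable {F K : Type*} [Field F] [Fintype F] [Field K] [Algebra F K] {D : QuadExt F K}
  {X : Type*} [AddCommGroup X] [Module K X] {h : X →ₗ[K] X →ₛₗ[conj F K] K}

/-- A sequence of mutually orthogonal hyperbolic pairs. -/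
def IsFrame (D : QuadExt F K) (h : X →ₗ[K] X →ₛₗ[conj F K] K) {m : ℕ} (v : Fin m → X × X) : Prop :=
  (∀ k, IsHypPair D h (v k)) ∧
    ∀ k l, k ≠ l → (v k).1 ∈ orth h (v l) ∧ (v k).2 ∈ orth h (v l)

theorem isFrame_cons (hh : IsHermitianForm h) {m : ℕ} {p : X × X} {v : Fin m → X × X} :
    IsFrame D h (Fin.cons p v : Fin (m + 1) → X × X) ↔
      IsHypPair D h p ∧ IsFrame D h v ∧ ∀ k, (v k).1 ∈ orth h p ∧ (v k).2 ∈ orth h p := by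
  simp only [IsFrame, Fin.forall_fin_succ, Fin.cons_zero, Fin.cons_succ, ne_eq,
    not_true_eq_false, IsEmpty.forall_iff, true_and, Fin.succ_inj]
  constructor
  · rintro ⟨⟨h1, h2⟩, -, h4⟩
    exact ⟨h1, ⟨h2, fun k => (h4 k).2⟩, fun k => (h4 k).1 (Fin.succ_ne_zero k)⟩
  · rintro ⟨h1, ⟨h2, h3⟩, h4⟩
    exact ⟨⟨h1, h2⟩, fun k _ => hh.mem_orth_symm (h4 k).1 (h4 k).2,
      fun k => ⟨fun _ => h4 k, h3 k⟩⟩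

/-- The induction step shared by the counts of all frames and of adapted frames: choose the pair at
position 0, then a frame in its orthogonal complement. The sets `S k` prescribe where the k-th pair
may lie. -/
theorem card_frames_succ [Finite X] (hh : IsHermitianForm h) {m : ℕ} (S : Fin (m + 1) → Set (X × X))
    (N₁ N₂ : ℕ) (h1 : Nat.card {p // p ∈ S 0 ∧ IsHypPair D h p} = N₁)
    (h2 : ∀ p ∈ S 0, IsHypPair D h p → Nat.card {v : Fin m → X × X // IsFrame D h v ∧
      ∀ k, v k ∈ S k.succ ∧ (v k).1 ∈ orth h p ∧ (v k).2 ∈ orth h p} = N₂) :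
    Nat.card {v : Fin (m + 1) → X × X // IsFrame D h v ∧ ∀ k, v k ∈ S k} = N₁ * N₂ := by
  have : Fintype {p // p ∈ S 0 ∧ IsHypPair D h p} := Fintype.ofFinite _
  have hsig : Nat.card (Σ p : {p // p ∈ S 0 ∧ IsHypPair D h p}, {v : Fin m → X × X // IsFrame D h v ∧
      ∀ k, v k ∈ S k.succ ∧ (v k).1 ∈ orth h p.1 ∧ (v k).2 ∈ orth h p.1}) = N₁ * N₂ := by
    rw [Nat.card_sigma, Finset.sum_congr rfl (fun p _ => h2 p.1 p.2.1 p.2.2), Finset.sum_const,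
      smul_eq_mul, Finset.card_univ, Fintype.card_eq_nat_card, h1]
  rw [← hsig]
  symm
  refine Nat.card_congr (Equiv.ofBijective (fun s => ⟨Fin.cons s.1.1 s.2.1, ?_, ?_⟩) ⟨?_, ?_⟩)
  · exact (isFrame_cons hh).2 ⟨s.1.2.2, s.2.2.1, fun k => (s.2.2.2 k).2⟩
  · refine Fin.cases ?_ (fun k => ?_)
    · simpa using s.1.2.1
    · simpa using (s.2.2.2 k).1
  · rintro ⟨⟨p, hp⟩, v, hv⟩ ⟨⟨p', hp'⟩, v', hv'⟩ he
    have he' : (Fin.cons p v : Fin (m + 1) → X × X) = Fin.cons p' v' := congrArg Subtype.val he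
    obtain ⟨rfl, rfl⟩ := Fin.cons_inj.1 he'
    rfl
  · rintro ⟨v, hv, hvS⟩
    rw [← Fin.cons_self_tail v, isFrame_cons hh] at hv
    exact ⟨⟨⟨v 0, hvS 0, hv.1⟩, ⟨Fin.tail v, hv.2.1, fun k => ⟨hvS k.succ, hv.2.2 k⟩⟩⟩,
      Subtype.ext (Fin.cons_self_tail v)⟩

theorem card_pairs {A : Type*} [Finite A] (S : Set A) (R : A → A → Prop) (N : ℕ)
    (hN : ∀ e ∈ S, Nat.card {f // R e f} = N) :
    Nat.card {p : A × A // p.1 ∈ S ∧ R p.1 p.2} = Nat.card S * N := by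
  have : Fintype S := Fintype.ofFinite _
  have hsig : Nat.card (Σ e : S, {f // R e f}) = Nat.card S * N := by
    rw [Nat.card_sigma, Finset.sum_congr rfl (fun e _ => hN e.1 e.2), Finset.sum_const,
      smul_eq_mul, Finset.card_univ, Fintype.card_eq_nat_card]
  rw [← hsig]
  exact Nat.card_congr ⟨fun p => ⟨⟨p.1.1, p.2.1⟩, p.1.2, p.2.2⟩,
    fun s => ⟨(s.1.1, s.2.1), s.1.2, s.2.2⟩, fun _ => rfl, fun _ => rfl⟩

theorem card_ne_zero_and {A : Type*} [Finite A] [Zero A] (P : A → Prop) (h0 : P 0) :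
    Nat.card {x // P x ∧ x ≠ 0} + 1 = Nat.card {x // P x} := by
  classical
  have : Fintype A := Fintype.ofFinite _
  rw [← Finite.card_option]
  symm
  refine Nat.card_congr ⟨fun x => if hx : x.1 = 0 then none else some ⟨x.1, x.2, hx⟩,
    fun o => o.elim ⟨0, h0⟩ fun x => ⟨x.1, x.2.1⟩, ?_, ?_⟩
  · rintro ⟨x, hx⟩
    by_cases hx0 : x = 0
    · subst hx0; simp
    · simp [hx0]
  · rintro (_ | ⟨x, hx, hx0⟩)
    · simp
    · simp [hx0]

/-- The number of frames of a non-degenerate space of dimension `2m`, i.e. the order of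
`GU(2m, q)`. -/
def frameCount (q : ℕ) : ℕ → ℕ
  | 0 => 1
  | m + 1 => (q ^ (2 * (m + 1)) - 1) * (q ^ (2 * m + 1) + 1) * q ^ (4 * m + 1) * frameCount q m

/-- The number of frames adapted to a maximal totally singular subspace with `i`-dimensional
core. -/
def adaptedCount (q : ℕ) : ℕ → ℕ → ℕ
  | 0, 0 => 1
  | _ + 1, 0 => 0
  | 0, m + 1 => (q ^ (2 * (m + 1)) - 1) * q ^ (2 * m + 1) * adaptedCount q 0 m
  | i + 1, m + 1 => (q ^ (2 * (i + 1)) - 1) * q ^ (4 * m + 1) * adaptedCount q i m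

theorem card_frames [Finite X] (hh : IsHermitianForm h) (D : QuadExt F K) :
    ∀ (m : ℕ) (Y : Submodule K X), NondegOn h Y → Nat.card Y = Fintype.card F ^ (4 * m) →
      Nat.card {v : Fin m → X × X // IsFrame D h v ∧ ∀ k, v k ∈ {p : X × X | p.1 ∈ Y ∧ p.2 ∈ Y}} =
        frameCount (Fintype.card F) m
  | 0, Y, _, _ => by
    rw [frameCount, Nat.card_eq_one_iff_unique]
    exact ⟨⟨fun a b => Subtype.ext (Subsingleton.elim _ _)⟩,
      ⟨⟨Fin.elim0, ⟨fun k => k.elim0, fun k => k.elim0⟩, fun k => k.elim0⟩⟩⟩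
  | m + 1, Y, hY, hc => by
    have hq : 1 < Fintype.card F := Fintype.one_lt_card
    rw [frameCount]
    refine card_frames_succ hh (fun _ => {p : X × X | p.1 ∈ Y ∧ p.2 ∈ Y}) _ _ ?_ ?_
    · have h1 := card_pairs {e : X | (e ∈ Y ∧ h e e = 0) ∧ e ≠ 0}
        (fun e f => f ∈ Y ∧ IsHypPair D h (e, f)) _
        (fun e he => hY.card_partners hh he.1.1 he.2 he.1.2 hc)
      have h2 := card_ne_zero_and (fun e : X => e ∈ Y ∧ h e e = 0) ⟨Y.zero_mem, by simp⟩
      have h3 := hY.card_isotropic hh D _ _ hc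
      -- The additive formula of `NondegOn.card_isotropic` factors once the zero vector has been
      -- removed.
      have h4 : Nat.card {e : X | (e ∈ Y ∧ h e e = 0) ∧ e ≠ 0} =
          (Fintype.card F ^ (2 * (m + 1)) - 1) * (Fintype.card F ^ (2 * m + 1) + 1) := by
        rw [← h2] at h3
        change (Nat.card {e : X | (e ∈ Y ∧ h e e = 0) ∧ e ≠ 0} + 1) * _ + _ = _ at h3
        generalize Nat.card {e : X | (e ∈ Y ∧ h e e = 0) ∧ e ≠ 0} = z at h3 ⊢
        have hpos : 1 ≤ Fintype.card F ^ (2 * (m + 1)) := Nat.one_le_pow _ _ (by omega)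
        apply Nat.eq_of_mul_eq_mul_right (show 0 < Fintype.card F by omega)
        zify [hpos] at h3 ⊢
        linear_combination h3
      rw [← h4, ← h1]
      refine Nat.card_congr (Equiv.subtypeEquivRight fun p => ?_)
      simp only [Set.mem_ofPred_eq]
      constructor
      · rintro ⟨⟨h1, h2⟩, hp⟩
        refine ⟨⟨⟨h1, hp.1⟩, fun h0 => D.ξ_ne_zero ?_⟩, h2, hp⟩
        rw [← hp.2.2, h0]; simp
      · rintro ⟨⟨⟨h1, -⟩, -⟩, h2, hp⟩
        exact ⟨⟨h1, h2⟩, hp⟩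
    · intro p hp hyp
      have hc' := card_inf_orth hh hyp hp.1 hp.2
      rw [hc, show 4 * (m + 1) = 4 + 4 * m by ring, pow_add] at hc'
      have hc'' := (Nat.eq_of_mul_eq_mul_left (by positivity) hc').symm
      rw [← card_frames hh D m _ (hY.inf_orth hh hyp hp.1 hp.2) hc'']
      refine Nat.card_congr (Equiv.subtypeEquivRight fun v => and_congr_right fun _ =>
        forall_congr' fun k => ?_)
      simp only [Set.mem_ofPred_eq, Submodule.mem_inf]
      tauto

end Frames

/-! ### Maximal totally singular subspaces -/

section Adapted

variable {F K : Type*} [Field F] [Fintype F] [Field K] [Algebra F K] {D : QuadExt F K}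
  {X : Type*} [AddCommGroup X] [Module K X] [Module F X] [IsScalarTower F K X]
  {h : X →ₗ[K] X →ₛₗ[conj F K] K}

/-- The largest `K`-subspace contained in an `F`-subspace. -/
def core (K : Type*) [Field K] [Algebra F K] [Module K X] (W : Submodule F X) : Submodule K X where
  carrier := {x | ∀ c : K, c • x ∈ W}
  add_mem' hx hy c := by rw [smul_add]; exact W.add_mem (hx c) (hy c)
  zero_mem' c := by rw [smul_zero]; exact W.zero_mem
  smul_mem' a x hx c := by rw [smul_smul]; exact hx _

theorem core_le {W : Submodule F X} {x : X} (hx : x ∈ core K W) : x ∈ W := by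
  simpa using hx 1

/-- `W` is a maximal totally singular `F`-subspace of `Y`, in terms of vectors. -/
structure IsMaxSingular (h : X →ₗ[K] X →ₛₗ[conj F K] K) (Y : Submodule K X)
    (W : Submodule F X) : Prop where
  le : ∀ x ∈ W, x ∈ Y
  singular : ∀ x ∈ W, h x x = 0
  maximal : ∀ x ∈ Y, h x x = 0 → (∀ y ∈ W, h x y + h y x = 0) → x ∈ W

theorem IsMaxSingular.add_eq_zero {Y : Submodule K X} {W : Submodule F X}
    (hW : IsMaxSingular h Y W) {x y : X} (hx : x ∈ W) (hy : y ∈ W) : h x y + h y x = 0 := by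
  have := hW.singular _ (W.add_mem hx hy)
  simpa [hW.singular x hx, hW.singular y hy, add_comm] using this

theorem IsMaxSingular.exists_eq (hh : IsHermitianForm h) (D : QuadExt F K) {Y : Submodule K X}
    {W : Submodule F X} (hW : IsMaxSingular h Y W) {x y : X} (hx : x ∈ W) (hy : y ∈ W) :
    ∃ a : F, algebraMap F K a * D.ξ = h x y := by
  apply (D.add_conj_eq_zero_iff _).1
  rw [hh]
  exact hW.add_eq_zero hx hy

/-- The core is the radical of the Hermitian form on `W`. -/
theorem IsMaxSingular.mem_core_iff (hh : IsHermitianForm h) (D : QuadExt F K) {Y : Submodule K X}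
    {W : Submodule F X} (hW : IsMaxSingular h Y W) {x : X} (hx : x ∈ W) :
    x ∈ core K W ↔ ∀ y ∈ W, h x y = 0 := by
  constructor
  · intro hc y hy
    obtain ⟨a, ha⟩ := hW.exists_eq hh D hx hy
    obtain ⟨b, hb⟩ := hW.exists_eq hh D (hc D.w) hy
    rw [map_smul, LinearMap.smul_apply, smul_eq_mul, ← ha, ← mul_assoc] at hb
    have hb' := mul_right_cancel₀ D.ξ_ne_zero hb
    by_contra hne
    have ha0 : a ≠ 0 := by
      rintro rfl
      exact hne (by rw [← ha]; simp)
    -- Here h(x, y) = aξ and w h(x, y) = bξ with a, b in `F`; if a ≠ 0, then w = b/a would lie in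
    -- `F`.
    apply D.smul_one_ne_w (b / a)
    rw [Algebra.smul_def, mul_one, map_div₀, hb']
    have : algebraMap F K a ≠ 0 := (map_ne_zero _).2 ha0
    field_simp
  -- Conversely, every multiple c x of a radical vector is singular and orthogonal to `W`, so
  -- maximality puts it into `W`.
  · intro h0 c
    refine hW.maximal _ (Y.smul_mem _ (hW.le x hx)) ?_ ?_
    · simp [hW.singular x hx]
    · intro y hy
      have h1 := h0 y hy
      simp [h1, hh.eq_zero_comm.1 h1]

/-- The intersection of an `F`-subspace with the orthogonal complement of a pair. -/
def infOrth (h : X →ₗ[K] X →ₛₗ[conj F K] K) (W : Submodule F X) (p : X × X) : Submodule F X :=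
  W ⊓ (orth h p).restrictScalars F

theorem mem_infOrth {W : Submodule F X} {p : X × X} {x : X} :
    x ∈ infOrth h W p ↔ x ∈ W ∧ x ∈ orth h p := Iff.rfl

theorem mem_core_infOrth {W : Submodule F X} {p : X × X} {x : X} :
    x ∈ core K (infOrth h W p) ↔ x ∈ core K W ∧ x ∈ orth h p := by
  constructor
  · intro hx
    exact ⟨fun c => (hx c).1, by simpa using (hx 1).2⟩
  · rintro ⟨h1, h2⟩ c
    exact ⟨h1 c, (orth h p).smul_mem c h2⟩

/-- When `W` is closed under the projection, a vector orthogonal to the pair has the same products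
with y in `W` as with the projection of y. Testing against the smaller subspace is therefore enough
for maximality. -/
theorem IsMaxSingular.to_infOrth (hh : IsHermitianForm h) {Y : Submodule K X} {W : Submodule F X}
    (hW : IsMaxSingular h Y W) {p : X × X} (hp : IsHypPair D h p)
    (hproj : ∀ x ∈ W, projOrth D h p x ∈ W) : IsMaxSingular h (Y ⊓ orth h p) (infOrth h W p) where
  le x hx := ⟨hW.le x hx.1, hx.2⟩
  singular x hx := hW.singular x hx.1
  maximal x hx hxx hxy := by
    refine ⟨hW.maximal x hx.1 hxx fun y hy => ?_, hx.2⟩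
    have hm := projOrth_mem hh hp y
    have h1 := hxy _ ⟨hproj y hy, hm⟩
    have h2 : h y x = h (projOrth D h p y) x := by
      conv_lhs => rw [← coeff_add_projOrth (D := D) (h := h) p y]
      rw [form_orth _ _ hh hx.2]
    rw [← hh y x, h2, hh, ← h1]

/-- The allowed positions for the `k`-th pair of an adapted frame. -/
def slots (i : ℕ) (Y : Submodule K X) (W : Submodule F X) (k : ℕ) : Set (X × X) :=
  {p | if k < i then p.1 ∈ core K W ∧ p.2 ∈ Y else p.1 ∈ W ∧ p.2 ∈ W}

/-- The truncated subtraction `i - 1` covers both inductive cases, from i + 1 to i and from 0 to 0.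
-/
theorem mem_slots_infOrth {i : ℕ} {Y : Submodule K X} {W : Submodule F X} {k : ℕ} {p r : X × X} :
    r ∈ slots (i - 1) (Y ⊓ orth h p) (infOrth h W p) k ↔
      r ∈ slots i Y W (k + 1) ∧ r.1 ∈ orth h p ∧ r.2 ∈ orth h p := by
  simp only [slots, Set.mem_ofPred_eq, Nat.lt_sub_iff_add_lt]
  split_ifs
  · rw [mem_core_infOrth, Submodule.mem_inf]; tauto
  · rw [mem_infOrth, mem_infOrth]; tauto

theorem algebraMap_smul_eq (a : F) (x : X) : algebraMap F K a • x = a • x :=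
  algebraMap_smul K a x

/-- The core is the radical, so the coefficient of `p.2` vanishes on `W`; only a `K`-multiple of
`p.1` is removed, and that lies in `W`. -/
theorem IsMaxSingular.projOrth_mem_of_core (hh : IsHermitianForm h) {Y : Submodule K X}
    {W : Submodule F X} (hW : IsMaxSingular h Y W) {p : X × X}
    (h1 : p.1 ∈ core K W) {x : X} (hx : x ∈ W) : projOrth D h p x ∈ W := by
  have : coeffR D h p x = 0 := by
    rw [coeffR, hh.eq_zero_comm.1 ((hW.mem_core_iff hh D (core_le h1)).1 h1 x hx), zero_div,
      neg_zero]
  rw [projOrth, this, zero_smul, sub_zero]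
  exact W.sub_mem hx (h1 _)

/-- On `W` the form has values in ξF, so coordinates with respect to a pair inside `W` lie in `F`.
-/
theorem IsMaxSingular.coeff_mem (hh : IsHermitianForm h) {Y : Submodule K X}
    {W : Submodule F X} (hW : IsMaxSingular h Y W) {p : X × X}
    (h1 : p.1 ∈ W) (h2 : p.2 ∈ W) {x : X} (hx : x ∈ W) :
    (∃ a : F, algebraMap F K a = coeffL D h p x) ∧ ∃ b : F, algebraMap F K b = coeffR D h p x := by
  have hξ := D.ξ_ne_zero
  obtain ⟨a, ha⟩ := hW.exists_eq hh D hx h2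
  obtain ⟨b, hb⟩ := hW.exists_eq hh D hx h1
  refine ⟨⟨a, ?_⟩, ⟨-b, ?_⟩⟩
  · rw [coeffL, ← ha]; field_simp
  · rw [coeffR, ← hb, map_neg]; field_simp

theorem IsMaxSingular.projOrth_mem_of_mem (hh : IsHermitianForm h) {Y : Submodule K X}
    {W : Submodule F X} (hW : IsMaxSingular h Y W) {p : X × X}
    (h1 : p.1 ∈ W) (h2 : p.2 ∈ W) {x : X} (hx : x ∈ W) : projOrth D h p x ∈ W := by
  obtain ⟨⟨a, ha⟩, ⟨b, hb⟩⟩ := hW.coeff_mem (D := D) hh h1 h2 hx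
  rw [projOrth, ← ha, ← hb, algebraMap_smul_eq, algebraMap_smul_eq]
  exact W.sub_mem (W.sub_mem hx (W.smul_mem _ h1)) (W.smul_mem _ h2)

/-- For e in the core, `W` is the direct sum of Ke and its part orthogonal to the pair; f itself is
not in `W`. The core decomposes in the same way. -/
theorem IsMaxSingular.card_of_core (hh : IsHermitianForm h) {Y : Submodule K X}
    {W : Submodule F X} (hW : IsMaxSingular h Y W) {p : X × X} (hp : IsHypPair D h p)
    (h1 : p.1 ∈ core K W) : Nat.card W = Fintype.card F ^ 2 * Nat.card (infOrth h W p) ∧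
      Nat.card (core K W) = Fintype.card F ^ 2 * Nat.card (core K (infOrth h W p)) := by
  have hξ := D.ξ_ne_zero
  have hb : ∀ a b : K, ∀ y ∈ orth h p, a • p.1 + b • p.2 + y ∈ W → b = 0 := by
    intro a b y hy hmem
    have := hh.eq_zero_comm.1 ((hW.mem_core_iff hh D (core_le h1)).1 h1 _ hmem)
    rw [form_fst _ _ hh hp hy, neg_eq_zero] at this
    exact (mul_eq_zero.1 this).resolve_right hξ
  constructor
  · have := card_eq_of_split hh hp (W : Set X) (infOrth h W p) Set.univ {0}
      (fun a b y hy => ?_) (fun y hy => hy.2)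
    · rw [Nat.card_univ, D.card_ext, Nat.card_unique (α := ({0} : Set K)), mul_one] at this
      exact this
    · simp only [SetLike.mem_coe, Set.mem_univ, true_and, Set.mem_singleton_iff]
      constructor
      · intro hm
        have hb0 := hb a b y hy hm
        subst hb0
        rw [zero_smul, add_zero] at hm
        exact ⟨rfl, (W.add_mem_iff_right (h1 a)).1 hm, hy⟩
      · rintro ⟨rfl, hm, -⟩
        rw [zero_smul, add_zero]
        exact W.add_mem (h1 a) hm
  · have := card_eq_of_split hh hp (core K W : Set X) (core K (infOrth h W p)) Set.univ {0}
      (fun a b y hy => ?_) (fun y hy => (mem_core_infOrth.1 hy).2)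
    · rw [Nat.card_univ, D.card_ext, Nat.card_unique (α := ({0} : Set K)), mul_one] at this
      exact this
    · simp only [SetLike.mem_coe, Set.mem_univ, true_and, Set.mem_singleton_iff, mem_core_infOrth]
      constructor
      · intro hm
        have hb0 := hb a b y hy (core_le hm)
        subst hb0
        rw [zero_smul, add_zero] at hm
        exact ⟨rfl, ((core K W).add_mem_iff_right ((core K W).smul_mem a h1)).1 hm, hy⟩
      · rintro ⟨rfl, hm, -⟩
        rw [zero_smul, add_zero]
        exact (core K W).add_mem ((core K W).smul_mem a h1) hm

theorem card_range_algebraMap : Nat.card (Set.range (algebraMap F K)) = Fintype.card F := by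
  rw [Fintype.card_eq_nat_card]
  exact (Nat.card_congr (Equiv.ofInjective _ (algebraMap F K).injective)).symm

/-- Here `W` is the direct sum of Fe, Ff and its part orthogonal to the pair. The partners of e
inside `W` are the vectors a e + f + y with a in `F`, and these are automatically isotropic. -/
theorem IsMaxSingular.card_of_mem (hh : IsHermitianForm h) {Y : Submodule K X}
    {W : Submodule F X} (hW : IsMaxSingular h Y W) {p : X × X} (hp : IsHypPair D h p)
    (h1 : p.1 ∈ W) (h2 : p.2 ∈ W) :
    Nat.card W = Fintype.card F ^ 2 * Nat.card (infOrth h W p) ∧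
      Nat.card {f // f ∈ W ∧ IsHypPair D h (p.1, f)} =
        Fintype.card F * Nat.card (infOrth h W p) := by
  have hξ := D.ξ_ne_zero
  have hab : ∀ a b : K, ∀ y ∈ orth h p, a • p.1 + b • p.2 + y ∈ W →
      a ∈ Set.range (algebraMap F K) ∧ b ∈ Set.range (algebraMap F K) := by
    intro a b y hy hmem
    obtain ⟨ha, hb⟩ := hW.coeff_mem (D := D) hh h1 h2 hmem
    rw [coeffL, form_snd _ _ hp hy, mul_div_cancel_right₀ _ hξ] at ha
    rw [coeffR, form_fst _ _ hh hp hy, neg_div, neg_neg, mul_div_cancel_right₀ _ hξ] at hb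
    exact ⟨ha, hb⟩
  have hmem : ∀ (a b : F) (y : X), algebraMap F K a • p.1 + algebraMap F K b • p.2 + y ∈ W ↔
      y ∈ W := by
    intro a b y
    rw [algebraMap_smul_eq, algebraMap_smul_eq]
    exact IsHypPair.smul_add_mem_iff h1 h2
  constructor
  · have := card_eq_of_split hh hp (W : Set X) (infOrth h W p)
      (Set.range (algebraMap F K)) (Set.range (algebraMap F K)) (fun a b y hy => ?_)
      (fun y hy => hy.2)
    · rw [card_range_algebraMap, ← pow_two] at this
      exact this
    · constructor
      · intro hm
        obtain ⟨⟨a, rfl⟩, ⟨b, rfl⟩⟩ := hab a b y hy hm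
        exact ⟨⟨a, rfl⟩, ⟨b, rfl⟩, (hmem a b y).1 hm, hy⟩
      · rintro ⟨⟨a, rfl⟩, ⟨b, rfl⟩, hm, -⟩
        exact (hmem a b y).2 hm
  · have := card_eq_of_split hh hp {f | f ∈ W ∧ IsHypPair D h (p.1, f)} (infOrth h W p)
      (Set.range (algebraMap F K)) {1} (fun a b y hy => ?_) (fun y hy => hy.2)
    · rw [card_range_algebraMap, Nat.card_unique (α := ({1} : Set K)), mul_one] at this
      exact this
    · have hξb : IsHypPair D h (p.1, a • p.1 + b • p.2 + y) ↔
          h (a • p.1 + b • p.2 + y) (a • p.1 + b • p.2 + y) = 0 ∧ b = 1 := by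
        simp only [IsHypPair, hp.1, true_and]
        refine and_congr_right fun _ => ?_
        rw [← hh, form_fst _ _ hh hp hy, map_neg, map_mul, D.conj_ξ, mul_neg, neg_neg]
        constructor
        · intro h'
          have h'' := mul_right_cancel₀ hξ (h'.trans (one_mul _).symm)
          rw [← D.conj_conj b, h'', map_one]
        · rintro rfl
          rw [map_one, one_mul]
      simp only [Set.mem_ofPred_eq, hξb, Set.mem_singleton_iff]
      constructor
      · rintro ⟨hm, -, rfl⟩
        obtain ⟨⟨a, rfl⟩, -⟩ := hab a 1 y hy hm
        rw [← map_one (algebraMap F K)] at hm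
        exact ⟨⟨a, rfl⟩, rfl, (hmem a 1 y).1 hm, hy⟩
      · rintro ⟨⟨a, rfl⟩, rfl, hm, -⟩
        have hm' : algebraMap F K a • p.1 + (1 : K) • p.2 + y ∈ W := by
          rw [← map_one (algebraMap F K)]
          exact (hmem a 1 y).2 hm
        exact ⟨hm', hW.singular _ hm', rfl⟩

theorem card_nonzero [Finite X] {R : Type*} [Ring R] [Module R X] (U : Submodule R X) :
    Nat.card {x : X | x ∈ U ∧ x ≠ 0} = Nat.card U - 1 := by
  have := card_ne_zero_and (fun x : X => x ∈ U) U.zero_mem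
  exact Nat.eq_sub_of_add_eq this

/-- A maximal totally singular subspace of a space of dimension `4m` has dimension `2m`, and the
number of its adapted frames depends only on the dimension of its core. -/
theorem IsMaxSingular.card_adapted [Finite X] (hh : IsHermitianForm h) (D : QuadExt F K) :
    ∀ (m i : ℕ) (Y : Submodule K X) (W : Submodule F X), NondegOn h Y →
      Nat.card Y = Fintype.card F ^ (4 * m) → IsMaxSingular h Y W →
      Nat.card (core K W) = Fintype.card F ^ (2 * i) →
      Nat.card W = Fintype.card F ^ (2 * m) ∧ i ≤ m ∧
      Nat.card {v : Fin m → X × X // IsFrame D h v ∧ ∀ k : Fin m, v k ∈ slots i Y W k} =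
        adaptedCount (Fintype.card F) i m
  | 0, i, Y, W, _, hc, hW, hi => by
    have hq : 1 < Fintype.card F := Fintype.one_lt_card
    rw [mul_zero, pow_zero, Nat.card_eq_one_iff_unique] at hc
    have hs := hc.1
    have hW0 : ∀ x ∈ W, x = 0 := fun x hx =>
      congrArg Subtype.val (Subsingleton.elim (⟨x, hW.le x hx⟩ : Y) 0)
    have hcore : Nat.card (core K W) = 1 := by
      rw [Nat.card_eq_one_iff_unique]
      exact ⟨⟨fun a b => Subtype.ext ((hW0 a (core_le a.2)).trans (hW0 b (core_le b.2)).symm)⟩, ⟨0⟩⟩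
    have hi0 : i = 0 := by
      rw [hcore] at hi
      by_contra hne
      exact absurd hi (Nat.one_lt_pow (by omega) hq).ne
    subst hi0
    refine ⟨?_, le_rfl, ?_⟩
    · rw [mul_zero, pow_zero, Nat.card_eq_one_iff_unique]
      exact ⟨⟨fun a b => Subtype.ext ((hW0 a a.2).trans (hW0 b b.2).symm)⟩, ⟨0⟩⟩
    · rw [adaptedCount, Nat.card_eq_one_iff_unique]
      exact ⟨⟨fun a b => Subtype.ext (Subsingleton.elim _ _)⟩,
        ⟨⟨Fin.elim0, ⟨fun k => k.elim0, fun k => k.elim0⟩, fun k => k.elim0⟩⟩⟩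
  | m + 1, i + 1, Y, W, hY, hc, hW, hi => by
    have hq : 1 < Fintype.card F := Fintype.one_lt_card
    -- Non-trivial core: the first pair starts in the core and its partner is any partner in `Y`.
    -- Splitting it off lowers both the dimension parameter and the core dimension by one.
    have key : ∀ p : X × X, p.1 ∈ core K W → p.2 ∈ Y → IsHypPair D h p →
        Nat.card W = Fintype.card F ^ (2 * (m + 1)) ∧ i ≤ m ∧
        Nat.card {v : Fin m → X × X // IsFrame D h v ∧
          ∀ k : Fin m, v k ∈ slots i (Y ⊓ orth h p) (infOrth h W p) k} =
            adaptedCount (Fintype.card F) i m := by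
      intro p h1 h2 hp
      have h1Y := hW.le _ (core_le h1)
      have hc' := card_inf_orth hh hp h1Y h2
      rw [hc, show 4 * (m + 1) = 4 + 4 * m by ring, pow_add] at hc'
      have hc'' := (Nat.eq_of_mul_eq_mul_left (by positivity) hc').symm
      have hcc := hW.card_of_core hh hp h1
      have hi' := hcc.2
      rw [hi, show 2 * (i + 1) = 2 + 2 * i by ring, pow_add] at hi'
      have hi'' := (Nat.eq_of_mul_eq_mul_left (by positivity) hi').symm
      obtain ⟨ih1, ih2, ih3⟩ := card_adapted hh D m i _ _ (hY.inf_orth hh hp h1Y h2) hc''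
        (hW.to_infOrth hh hp fun x hx => hW.projOrth_mem_of_core hh h1 hx) hi''
      exact ⟨by rw [hcc.1, ih1]; ring, ih2, ih3⟩
    have hpartner : ∀ e ∈ {x : X | x ∈ core K W ∧ x ≠ 0},
        Nat.card {f // f ∈ Y ∧ IsHypPair D h (e, f)} = Fintype.card F ^ (4 * m + 1) := fun e he =>
      hY.card_partners hh (hW.le _ (core_le he.1)) he.2 (hW.singular _ (core_le he.1)) hc
    have hpos : Nat.card {x : X | x ∈ core K W ∧ x ≠ 0} =
        Fintype.card F ^ (2 * (i + 1)) - 1 := by rw [card_nonzero, hi]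
    have h1lt : 1 < Fintype.card F ^ (2 * (i + 1)) := Nat.one_lt_pow (by omega) hq
    obtain ⟨⟨e, he, he0⟩⟩ : Nonempty {x : X | x ∈ core K W ∧ x ≠ 0} := by
      apply (Nat.card_pos_iff.1 _).1
      omega
    obtain ⟨f, hf, hef⟩ := hY.exists_partner (D := D) hh (hW.le _ (core_le he)) he0
      (hW.singular _ (core_le he))
    obtain ⟨k1, k2, -⟩ := key (e, f) he hf hef
    refine ⟨k1, by omega, ?_⟩
    rw [adaptedCount]
    refine card_frames_succ hh (fun k : Fin (m + 1) => slots (i + 1) Y W k) _ _ ?_ ?_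
    · rw [← hpos, ← card_pairs _ (fun e f => f ∈ Y ∧ IsHypPair D h (e, f)) _ hpartner]
      refine Nat.card_congr (Equiv.subtypeEquivRight fun p => ?_)
      simp only [slots, Fin.val_zero, Nat.zero_lt_succ, if_true, Set.mem_ofPred_eq]
      constructor
      · rintro ⟨⟨h1, h2⟩, hp⟩
        refine ⟨⟨h1, fun h0 => D.ξ_ne_zero ?_⟩, h2, hp⟩
        rw [← hp.2.2, h0]; simp
      · rintro ⟨⟨h1, -⟩, h2, hp⟩
        exact ⟨⟨h1, h2⟩, hp⟩
    · intro p hp0 hp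
      simp only [slots, Fin.val_zero, Nat.zero_lt_succ, if_true, Set.mem_ofPred_eq] at hp0
      rw [← (key p hp0.1 hp0.2 hp).2.2]
      refine Nat.card_congr (Equiv.subtypeEquivRight fun v => and_congr_right fun _ =>
        forall_congr' fun k => ?_)
      exact (mem_slots_infOrth (i := i + 1)).symm
  | m + 1, 0, Y, W, hY, hc, hW, hi => by
    have hq : 1 < Fintype.card F := Fintype.one_lt_card
    have hcore0 : ∀ x ∈ core K W, x = 0 := by
      rw [mul_zero, pow_zero, Nat.card_eq_one_iff_unique] at hi
      have hs := hi.1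
      exact fun x hx => congrArg Subtype.val (Subsingleton.elim (⟨x, hx⟩ : core K W) 0)
    -- Trivial core: the form is non-degenerate on `W`, so both members of the first pair can be
    -- taken in `W`, and the core of what remains is again trivial.
    have key : ∀ p : X × X, p.1 ∈ W → p.2 ∈ W → IsHypPair D h p →
        Nat.card W = Fintype.card F ^ (2 * (m + 1)) ∧
        Nat.card {f // f ∈ W ∧ IsHypPair D h (p.1, f)} = Fintype.card F ^ (2 * m + 1) ∧
        Nat.card {v : Fin m → X × X // IsFrame D h v ∧
          ∀ k : Fin m, v k ∈ slots 0 (Y ⊓ orth h p) (infOrth h W p) k} =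
            adaptedCount (Fintype.card F) 0 m := by
      intro p h1 h2 hp
      have hc' := card_inf_orth hh hp (hW.le _ h1) (hW.le _ h2)
      rw [hc, show 4 * (m + 1) = 4 + 4 * m by ring, pow_add] at hc'
      have hc'' := (Nat.eq_of_mul_eq_mul_left (by positivity) hc').symm
      have hcc := hW.card_of_mem hh hp h1 h2
      have hi' : Nat.card (core K (infOrth h W p)) = Fintype.card F ^ (2 * 0) := by
        rw [mul_zero, pow_zero, Nat.card_eq_one_iff_unique]
        exact ⟨⟨fun a b => Subtype.ext ((hcore0 a (mem_core_infOrth.1 a.2).1).trans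
          (hcore0 b (mem_core_infOrth.1 b.2).1).symm)⟩, ⟨0⟩⟩
      obtain ⟨ih1, -, ih3⟩ := card_adapted hh D m 0 _ _
        (hY.inf_orth hh hp (hW.le _ h1) (hW.le _ h2)) hc''
        (hW.to_infOrth hh hp fun x hx => hW.projOrth_mem_of_mem hh h1 h2 hx) hi'
      exact ⟨by rw [hcc.1, ih1]; ring, by rw [hcc.2, ih1]; ring, ih3⟩
    have hex : ∀ e ∈ {x : X | x ∈ W ∧ x ≠ 0}, ∃ f ∈ W, IsHypPair D h (e, f) := by
      rintro e ⟨he, he0⟩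
      obtain ⟨z, hz, hez⟩ : ∃ z ∈ W, h e z ≠ 0 := by
        by_contra! hcon
        exact he0 (hcore0 e ((hW.mem_core_iff hh D he).2 hcon))
      -- The product h(e, z) is aξ with a in `F`, so the rescaling to ξ uses an `F`-scalar and stays
      -- in `W`.
      obtain ⟨a, ha⟩ := hW.exists_eq hh D he hz
      have ha0 : algebraMap F K a ≠ 0 := by
        intro h0
        exact hez (by rw [← ha, h0, zero_mul])
      refine ⟨a⁻¹ • z, W.smul_mem _ hz, hW.singular _ he, hW.singular _ (W.smul_mem _ hz), ?_⟩
      rw [← algebraMap_smul_eq (K := K), LinearMap.map_smulₛₗ, conj_algebraMap, ← ha, map_inv₀,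
        smul_eq_mul]
      field_simp
    have hpartner : ∀ e ∈ {x : X | x ∈ W ∧ x ≠ 0},
        Nat.card {f // f ∈ W ∧ IsHypPair D h (e, f)} = Fintype.card F ^ (2 * m + 1) := by
      intro e he
      obtain ⟨f, hf, hef⟩ := hex e he
      exact (key (e, f) he.1 hf hef).2.1
    -- `W` is not zero: by maximality the zero subspace would have to contain every isotropic vector
    -- of `Y`.
    obtain ⟨e, he⟩ : ∃ e, e ∈ {x : X | x ∈ W ∧ x ≠ 0} := by
      obtain ⟨e, he, he0, hee⟩ := exists_isotropic (Y := Y) hh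
        (by rw [hc]; exact Nat.pow_lt_pow_right hq (by omega)) D
      by_cases hcon : ∀ x ∈ W, x = 0
      · exact ⟨e, hW.maximal e he hee fun y hy => by rw [hcon y hy]; simp, he0⟩
      · push Not at hcon
        exact hcon
    obtain ⟨f, hf, hef⟩ := hex e he
    obtain ⟨k1, -, -⟩ := key (e, f) he.1 hf hef
    refine ⟨k1, Nat.zero_le _, ?_⟩
    rw [adaptedCount]
    refine card_frames_succ hh (fun k : Fin (m + 1) => slots 0 Y W k) _ _ ?_ ?_
    -- The number of choices for e is |W| - 1, which is why the size of `W` is carried along in the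
    -- induction.
    · rw [← k1, ← card_nonzero, ← card_pairs _ (fun e f => f ∈ W ∧ IsHypPair D h (e, f)) _ hpartner]
      refine Nat.card_congr (Equiv.subtypeEquivRight fun p => ?_)
      simp only [slots, Nat.not_lt_zero, if_false, Set.mem_ofPred_eq]
      constructor
      · rintro ⟨⟨h1, h2⟩, hp⟩
        refine ⟨⟨h1, fun h0 => D.ξ_ne_zero ?_⟩, h2, hp⟩
        rw [← hp.2.2, h0]; simp
      · rintro ⟨⟨h1, -⟩, h2, hp⟩
        exact ⟨⟨h1, h2⟩, hp⟩
    · intro p hp0 hp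
      simp only [slots, Nat.not_lt_zero, if_false, Set.mem_ofPred_eq] at hp0
      rw [← (key p hp0.1 hp0.2 hp).2.2]
      refine Nat.card_congr (Equiv.subtypeEquivRight fun v => and_congr_right fun _ =>
        forall_congr' fun k => ?_)
      exact (mem_slots_infOrth (i := 0)).symm

end Adapted

/-! ### The Hermitian space `V(2n, q²)` -/

section Space

variable {F K : Type*} [Field F] [Fintype F] [Field K] [Algebra F K] (D : QuadExt F K) (n : ℕ)

theorem J_apply (i j : Idx n) : D.J n i j =
    if i.2 = j.2 then !![0, D.ξ; -D.ξ, 0] i.1 j.1 else 0 := by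
  have : D.ξ ^ Fintype.card F = -D.ξ := D.conj_ξ
  rw [J, Matrix.blockDiagonal_apply, this]

theorem H_eq_sum (x y : Idx n → K) : D.H n x y =
    D.ξ * ∑ k, (x (0, k) * conj F K (y (1, k)) - x (1, k) * conj F K (y (0, k))) := by
  rw [H, dotProduct, Fintype.sum_prod_type_right, Finset.mul_sum]
  refine Finset.sum_congr rfl fun k _ => ?_
  simp only [Fin.sum_univ_two, Matrix.mulVec, dotProduct, Fintype.sum_prod_type_right, J_apply,
    conj_apply]
  simp
  ring

/-- The Hermitian form `H` as a sesquilinear map. -/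
def form : (Idx n → K) →ₗ[K] (Idx n → K) →ₛₗ[conj F K] K :=
  LinearMap.mk₂'ₛₗ (RingHom.id K) (conj F K) (D.H n)
    (fun x x' y => by
      simp only [H_eq_sum, ← mul_add, ← Finset.sum_add_distrib, Pi.add_apply]
      congr 1; refine Finset.sum_congr rfl fun k _ => ?_; ring)
    (fun c x y => by
      simp only [H_eq_sum, Pi.smul_apply, smul_eq_mul, RingHom.id_apply, mul_left_comm c,
        Finset.mul_sum]
      refine Finset.sum_congr rfl fun k _ => ?_; ring)
    (fun x y y' => by
      simp only [H_eq_sum, ← mul_add, ← Finset.sum_add_distrib, Pi.add_apply, map_add]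
      congr 1; refine Finset.sum_congr rfl fun k _ => ?_; ring)
    (fun c x y => by
      simp only [H_eq_sum, Pi.smul_apply, smul_eq_mul, map_mul, mul_left_comm (conj F K c),
        Finset.mul_sum]
      refine Finset.sum_congr rfl fun k _ => ?_; ring)

theorem form_apply (x y : Idx n → K) : D.form n x y = D.H n x y := rfl

theorem form_isHermitian : IsHermitianForm (D.form n) := by
  intro x y
  simp only [form_apply, H_eq_sum, map_mul, map_sum, map_sub, D.conj_ξ, D.conj_conj, neg_mul,
    Finset.mul_sum]
  refine Finset.sum_congr rfl fun k _ => ?_; ring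

theorem form_single_zero (x : Idx n → K) (k : Fin n) (c : K) :
    D.form n x (Pi.single (0, k) c) = -(D.ξ * (x (1, k) * conj F K c)) := by
  classical
  rw [form_apply, H_eq_sum, Finset.sum_eq_single k]
  · simp
  · intro l _ hl
    simp [hl]
  · simp

theorem form_single_one (x : Idx n → K) (k : Fin n) (c : K) :
    D.form n x (Pi.single (1, k) c) = D.ξ * (x (0, k) * conj F K c) := by
  classical
  rw [form_apply, H_eq_sum, Finset.sum_eq_single k]
  · simp
  · intro l _ hl
    simp [hl]
  · simp

theorem form_nondegOn_top : NondegOn (D.form n) ⊤ := by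
  intro y _ hy
  have hξ := D.ξ_ne_zero
  funext ⟨a, k⟩
  have h0 := hy (Pi.single (0, k) 1) trivial
  have h1 := hy (Pi.single (1, k) 1) trivial
  rw [form_single_zero, map_one, mul_one, neg_eq_zero] at h0
  rw [form_single_one, map_one, mul_one] at h1
  fin_cases a
  · exact (mul_eq_zero.1 h1).resolve_left hξ
  · exact (mul_eq_zero.1 h0).resolve_left hξ

theorem finite_space (D : QuadExt F K) (n : ℕ) : Finite (Idx n → K) :=
  have := D.finite_ext
  inferInstance

theorem card_space (D : QuadExt F K) (n : ℕ) :
    Nat.card (⊤ : Submodule K (Idx n → K)) = Fintype.card F ^ (4 * n) := by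
  have := D.finite_ext
  rw [Nat.card_congr (Submodule.topEquiv (R := K) (M := Idx n → K)).toEquiv, Nat.card_fun, D.card_ext,
    Nat.card_eq_fintype_card (α := Idx n), Fintype.card_prod, Fintype.card_fin, Fintype.card_fin,
    ← pow_mul]
  congr 1
  ring

/-! ### Unitary matrices and frames -/

theorem gram_apply (M : Matrix (Idx n) (Idx n) K) (i j : Idx n) :
    (Mᵀ * D.J n * M.map (FiniteField.frobeniusAlgHom F K)) i j =
      D.form n (fun l => M l i) (fun l => M l j) := by
  rw [Matrix.mul_assoc, Matrix.mul_apply, form_apply, H, dotProduct]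
  refine Finset.sum_congr rfl fun l _ => ?_
  rw [Matrix.transpose_apply, Matrix.mul_apply, Matrix.mulVec, dotProduct]
  rfl

theorem mem_GU_iff_form (M : GL (Idx n) K) :
    M ∈ D.GU n ↔ ∀ i j, D.form n (fun l => M l i) (fun l => M l j) = D.J n i j := by
  change (M : Matrix (Idx n) (Idx n) K)ᵀ * D.J n *
    (M : Matrix (Idx n) (Idx n) K).map (FiniteField.frobeniusAlgHom F K) = D.J n ↔ _
  rw [← Matrix.ext_iff]
  simp only [gram_apply]

/-- The pairs of columns of a matrix. -/
def colPairs {n : ℕ} (M : Matrix (Idx n) (Idx n) K) (k : Fin n) : (Idx n → K) × (Idx n → K) :=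
  (fun l => M l (0, k), fun l => M l (1, k))

theorem isFrame_colPairs_iff (M : Matrix (Idx n) (Idx n) K) :
    IsFrame D (D.form n) (colPairs M) ↔
      ∀ i j, D.form n (fun l => M l i) (fun l => M l j) = D.J n i j := by
  constructor
  · rintro ⟨h1, h2⟩ ⟨a, k⟩ ⟨b, l⟩
    rw [J_apply]
    by_cases hkl : k = l
    · subst hkl
      have hp := h1 k
      have hf := hp.flip_eq (D.form_isHermitian n)
      obtain ⟨e1, e2, e3⟩ := hp
      simp only [if_true]
      fin_cases a <;> fin_cases b
      · exact e1
      · exact e3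
      · exact hf
      · exact e2
    · have h3 := h2 k l hkl
      rw [mem_orth, mem_orth] at h3
      simp only [hkl, if_false]
      fin_cases a <;> fin_cases b
      · exact h3.1.1
      · exact h3.1.2
      · exact h3.2.1
      · exact h3.2.2
  · intro h
    refine ⟨fun k => ⟨?_, ?_, ?_⟩, fun k l hkl => ?_⟩
    · exact (h (0, k) (0, k)).trans (by simp [J_apply])
    · exact (h (1, k) (1, k)).trans (by simp [J_apply])
    · exact (h (0, k) (1, k)).trans (by simp [J_apply])
    · rw [mem_orth, mem_orth]
      refine ⟨⟨?_, ?_⟩, ⟨?_, ?_⟩⟩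
      · exact (h (0, k) (0, l)).trans (by simp [J_apply, hkl])
      · exact (h (0, k) (1, l)).trans (by simp [J_apply, hkl])
      · exact (h (1, k) (0, l)).trans (by simp [J_apply, hkl])
      · exact (h (1, k) (1, l)).trans (by simp [J_apply, hkl])

theorem J_mul_J : D.J n * D.J n = -(D.ξ ^ 2) • (1 : Matrix (Idx n) (Idx n) K) := by
  have : D.ξ ^ Fintype.card F = -D.ξ := D.conj_ξ
  rw [J, ← Matrix.blockDiagonal_mul, ← Matrix.blockDiagonal_one, ← Matrix.blockDiagonal_smul, this]
  congr 1
  funext k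
  ext i j
  fin_cases i <;> fin_cases j <;> simp [pow_two]

/-- J² is a non-zero scalar, so the Gram equation exhibits an inverse of the transpose. Hence every
frame is the set of columns of an invertible matrix. -/
theorem isUnit_of_gram (M : Matrix (Idx n) (Idx n) K)
    (h : Mᵀ * D.J n * M.map (FiniteField.frobeniusAlgHom F K) = D.J n) : IsUnit M := by
  have hξ := D.ξ_ne_zero
  have h1 : Mᵀ * (-(D.ξ ^ 2)⁻¹ • (D.J n * M.map (FiniteField.frobeniusAlgHom F K) * D.J n)) = 1 := by
    rw [Matrix.mul_smul, ← Matrix.mul_assoc, ← Matrix.mul_assoc, h, J_mul_J, smul_smul]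
    rw [show -(D.ξ ^ 2)⁻¹ * -(D.ξ ^ 2) = 1 by field_simp, one_smul]
  have h2 : IsUnit Mᵀ := IsUnit.of_mul_eq_one _ h1
  rwa [Matrix.isUnit_transpose] at h2

/-- Unitary matrices correspond to frames. -/
def frameEquiv : D.GU n ≃ {v : Fin n → (Idx n → K) × (Idx n → K) // IsFrame D (D.form n) v} :=
  Equiv.ofBijective (fun M => ⟨colPairs (M : GL (Idx n) K).1,
    (D.isFrame_colPairs_iff n _).2 ((D.mem_GU_iff_form n _).1 M.2)⟩) (by
  constructor
  · intro M N h
    have h' : colPairs (M : GL (Idx n) K).1 = colPairs (N : GL (Idx n) K).1 :=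
      congrArg Subtype.val h
    refine Subtype.ext (Units.ext (Matrix.ext fun l ⟨a, k⟩ => ?_))
    have hk := congrFun h' k
    fin_cases a
    · exact congrFun (congrArg Prod.fst hk) l
    · exact congrFun (congrArg Prod.snd hk) l
  · rintro ⟨v, hv⟩
    let M : Matrix (Idx n) (Idx n) K := fun l j => if j.1 = 0 then (v j.2).1 l else (v j.2).2 l
    have hM : colPairs M = v := by
      funext k
      simp [colPairs, M]
    rw [← hM, isFrame_colPairs_iff] at hv
    have hg : Mᵀ * D.J n * M.map (FiniteField.frobeniusAlgHom F K) = D.J n := by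
      ext i j
      rw [gram_apply, hv]
    refine ⟨⟨(D.isUnit_of_gram n M hg).unit, hg⟩, Subtype.ext hM⟩)

theorem frameEquiv_apply (M : D.GU n) : (D.frameEquiv n M).1 = colPairs (M : GL (Idx n) K).1 := rfl

theorem card_GU : Nat.card (D.GU n) = frameCount (Fintype.card F) n := by
  have := D.finite_space n
  rw [Nat.card_congr (D.frameEquiv n), ← card_frames (D.form_isHermitian n) D n ⊤
    (D.form_nondegOn_top n) (D.card_space n)]
  exact Nat.card_congr (Equiv.subtypeEquivRight fun v => by simp)

theorem form_mulVec {M : GL (Idx n) K} (hM : M ∈ D.GU n) (x y : Idx n → K) :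
    D.form n (M.1 *ᵥ x) (M.1 *ᵥ y) = D.form n x y := by
  have hf : (fun i => (M.1 *ᵥ y) i ^ Fintype.card F) =
      M.1.map (FiniteField.frobeniusAlgHom F K) *ᵥ fun i => y i ^ Fintype.card F := by
    funext i
    have := map_sum (conj F K) (fun j => M.1 i j * y j) Finset.univ
    simp only [map_mul] at this
    exact this
  have hM' : M.1ᵀ * D.J n * M.1.map (FiniteField.frobeniusAlgHom F K) = D.J n := hM
  rw [form_apply, form_apply, H, H, hf]
  conv_rhs => rw [← hM']
  rw [← Matrix.mulVec_mulVec, ← Matrix.mulVec_mulVec, Matrix.dotProduct_mulVec x,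
    Matrix.vecMul_transpose]

/-- The norm of the determinant of a unitary matrix is one. -/
theorem det_mul_conj_det {M : GL (Idx n) K} (hM : M ∈ D.GU n) :
    M.1.det * conj F K M.1.det = 1 := by
  have hM' : M.1ᵀ * D.J n * M.1.map (FiniteField.frobeniusAlgHom F K) = D.J n := hM
  have hJ : (D.J n).det ≠ 0 := by
    intro h0
    have := congrArg Matrix.det (D.J_mul_J n)
    rw [Matrix.det_mul, h0, mul_zero, Matrix.det_smul, Matrix.det_one, mul_one] at this
    exact pow_ne_zero _ (neg_ne_zero.2 (pow_ne_zero 2 D.ξ_ne_zero)) this.symm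
  have h1 := congrArg Matrix.det hM'
  have h2 : (M.1.map (FiniteField.frobeniusAlgHom F K)).det = conj F K M.1.det :=
    (RingHom.map_det (conj F K) M.1).symm
  rw [Matrix.det_mul, Matrix.det_mul, Matrix.det_transpose, h2] at h1
  apply mul_right_cancel₀ hJ
  linear_combination h1

/-- A unitary matrix of given determinant that is diagonal. -/
theorem exists_diagonal {d : K} (hd : d * conj F K d = 1) (k₀ : Fin n) :
    ∃ M ∈ D.GU n, M.1.det = d ∧ ∃ a : K, M.1 = Matrix.diagonal
      (fun i => if i = (0, k₀) then a else if i = (1, k₀) then (conj F K a)⁻¹ else 1) := by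
  obtain ⟨a, ha0, ha⟩ := D.exists_div_conj_eq d hd
  have hca : conj F K a ≠ 0 := (map_ne_zero _).2 ha0
  set t : Idx n → K := fun i => if i = (0, k₀) then a else if i = (1, k₀) then (conj F K a)⁻¹ else 1
    with ht
  have hdet : (Matrix.diagonal t).det = d := by
    rw [Matrix.det_diagonal, Fintype.prod_prod_type_right, Finset.prod_eq_single k₀]
    · simp [Fin.prod_univ_two, ht, ← ha, div_eq_mul_inv]
    · intro k _ hk
      simp [ht, hk]
    · simp
  have hg : (Matrix.diagonal t)ᵀ * D.J n *
      (Matrix.diagonal t).map (FiniteField.frobeniusAlgHom F K) = D.J n := by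
    rw [Matrix.diagonal_transpose, Matrix.diagonal_map (map_zero _)]
    ext ⟨i, k⟩ ⟨j, l⟩
    rw [Matrix.mul_diagonal, Matrix.diagonal_mul, J_apply]
    by_cases hkl : k = l
    · subst hkl
      by_cases hk : k = k₀
      · subst hk
        change t (i, k) * _ * conj F K (t (j, k)) = _
        fin_cases i <;> fin_cases j <;> simp [ht, D.conj_conj] <;> field_simp
      · change t (i, k) * _ * conj F K (t (j, k)) = _
        have e1 : t (i, k) = 1 := by simp [ht, hk]
        have e2 : t (j, k) = 1 := by simp [ht, hk]
        rw [e1, e2]; simp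
    · simp [hkl]
  exact ⟨(D.isUnit_of_gram n _ hg).unit, hg, hdet, a, rfl⟩

/-- A unitary matrix fixed by the conjugation has determinant one. -/
theorem det_eq_one_of_conj_eq {M : GL (Idx n) K} (hM : M ∈ D.GU n)
    (hc : ∀ i j, conj F K (M.1 i j) = M.1 i j) : M.1.det = 1 := by
  have hM' : M.1ᵀ * D.J n * M.1.map (FiniteField.frobeniusAlgHom F K) = D.J n := hM
  have hmap : M.1.map (FiniteField.frobeniusAlgHom F K) = M.1 := Matrix.ext hc
  rw [hmap] at hM'
  -- Listing all indices (0, k) before all (1, k) turns J into -ξ times the standard symplectic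
  -- matrix, and symplectic matrices have determinant 1.
  let e : Idx n ≃ Fin n ⊕ Fin n :=
    (finTwoEquiv.prodCongr (Equiv.refl _)).trans (Equiv.boolProdEquivSum _)
  have hJ : D.J n = (-D.ξ) • (Matrix.J (Fin n) K).submatrix e e := by
    ext ⟨i, k⟩ ⟨j, l⟩
    rw [J_apply]
    by_cases hkl : k = l <;> fin_cases i <;> fin_cases j <;>
      simp [e, Matrix.J, finTwoEquiv, Equiv.boolProdEquivSum, hkl]
  have hξ : (-D.ξ) ≠ 0 := neg_ne_zero.2 D.ξ_ne_zero
  have h1 : (M.1.submatrix e.symm e.symm)ᵀ ∈ Matrix.symplecticGroup (Fin n) K := by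
    rw [SymplecticGroup.mem_iff, Matrix.transpose_transpose]
    rw [hJ, Matrix.mul_smul, Matrix.smul_mul] at hM'
    have h2 := congrArg (fun A => A.submatrix e.symm e.symm) (smul_right_injective _ hξ hM')
    simp only [Matrix.submatrix_submatrix, Equiv.self_comp_symm, Matrix.submatrix_id_id] at h2
    conv_rhs => rw [← h2]
    rw [← Matrix.submatrix_mul_equiv _ _ _ e.symm _, ← Matrix.submatrix_mul_equiv _ _ _ e.symm _]
    simp
  have h3 := SymplecticGroup.det_eq_one h1
  rwa [Matrix.det_transpose, Matrix.det_submatrix_equiv_self] at h3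

end Space

/-! ### The action on `F`-subspaces of `V(2n, q²)` -/

section Action

variable {F K : Type*} [Field F] [Fintype F] [Field K] [Algebra F K] (D : QuadExt F K) {n : ℕ}

variable (F) in
/-- The `F`-linear bijection `x ↦ M x`. -/
def act (M : GL (Idx n) K) : (Idx n → K) ≃ₗ[F] (Idx n → K) :=
  (LinearMap.GeneralLinearGroup.generalLinearEquiv K (Idx n → K)
      (Matrix.GeneralLinearGroup.toLin M)).restrictScalars F

@[simp] theorem act_apply (M : GL (Idx n) K) (x : Idx n → K) : act F M x = M.1 *ᵥ x := by
  simp [act, Matrix.GeneralLinearGroup.toLin]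

/-- The image of an `F`-subspace under an invertible matrix. -/
def moved (M : GL (Idx n) K) (T : Submodule F (Idx n → K)) : Submodule F (Idx n → K) :=
  T.map (act F M : (Idx n → K) →ₗ[F] (Idx n → K))

theorem mem_moved {M : GL (Idx n) K} {T : Submodule F (Idx n → K)} {x : Idx n → K} :
    x ∈ moved M T ↔ ∃ y ∈ T, M.1 *ᵥ y = x := by
  rw [moved, Submodule.mem_map]
  simp only [LinearEquiv.coe_coe, act_apply]

theorem mulVec_mem_moved {M : GL (Idx n) K} {T : Submodule F (Idx n → K)} {x : Idx n → K} :
    M.1 *ᵥ x ∈ moved M T ↔ x ∈ T := by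
  constructor
  · intro h
    obtain ⟨y, hy, he⟩ := mem_moved.1 h
    rw [← act_apply (F := F), ← act_apply (F := F)] at he
    rwa [← (act F M).injective he]
  · exact fun h => mem_moved.2 ⟨x, h, rfl⟩

theorem moved_mul (M N : GL (Idx n) K) (T : Submodule F (Idx n → K)) :
    moved (M * N) T = moved M (moved N T) := by
  ext x
  simp only [mem_moved, Units.val_mul]
  constructor
  · rintro ⟨y, hy, rfl⟩
    exact ⟨_, ⟨y, hy, rfl⟩, by rw [Matrix.mulVec_mulVec]⟩
  · rintro ⟨_, ⟨y, hy, rfl⟩, rfl⟩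
    exact ⟨y, hy, by rw [Matrix.mulVec_mulVec]⟩

theorem moved_one (T : Submodule F (Idx n → K)) : moved (1 : GL (Idx n) K) T = T := by
  ext x
  simp [mem_moved]

theorem moved_injective (M : GL (Idx n) K) :
    Function.Injective (moved M : Submodule F (Idx n → K) → _) := by
  intro T T' h
  rw [← moved_one (K := K) T, ← moved_one (K := K) T', ← inv_mul_cancel M, moved_mul, h, moved_mul]

theorem exists_mulVec_eq (M : GL (Idx n) K) (x : Idx n → K) : ∃ y, M.1 *ᵥ y = x := by
  exact ⟨M⁻¹.1 *ᵥ x, by rw [Matrix.mulVec_mulVec, ← Units.val_mul, mul_inv_cancel]; simp⟩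

theorem IsMaxSingular.moved {M : GL (Idx n) K} (hM : M ∈ D.GU n) {T : Submodule F (Idx n → K)}
    (hT : IsMaxSingular (D.form n) ⊤ T) : IsMaxSingular (D.form n) ⊤ (moved M T) where
  le _ _ := trivial
  singular x hx := by
    obtain ⟨y, hy, rfl⟩ := mem_moved.1 hx
    rw [D.form_mulVec n hM, hT.singular y hy]
  maximal x _ hxx hxy := by
    obtain ⟨y, rfl⟩ := exists_mulVec_eq M x
    refine mulVec_mem_moved.2 (hT.maximal y trivial ?_ fun z hz => ?_)
    · rwa [D.form_mulVec n hM] at hxx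
    · have := hxy _ (mulVec_mem_moved.2 hz)
      rwa [D.form_mulVec n hM, D.form_mulVec n hM] at this

theorem card_core_moved (M : GL (Idx n) K) (T : Submodule F (Idx n → K)) :
    Nat.card (core K (moved M T)) = Nat.card (core K T) := by
  have hmem : ∀ x : Idx n → K, M.1 *ᵥ x ∈ core K (moved M T) ↔ x ∈ core K T := fun x =>
    forall_congr' fun c => by rw [← Matrix.mulVec_smul, mulVec_mem_moved]
  symm
  refine Nat.card_congr (Equiv.ofBijective (fun x => ⟨M.1 *ᵥ x, (hmem _).2 x.2⟩) ⟨?_, ?_⟩)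
  · intro x y h
    have h' := congrArg Subtype.val h
    simp only [← act_apply (F := F)] at h'
    exact Subtype.ext ((act F M).injective h')
  · rintro ⟨x, hx⟩
    obtain ⟨y, rfl⟩ := exists_mulVec_eq M x
    exact ⟨⟨y, (hmem y).1 hx⟩, rfl⟩

/-- Vectors of the larger subspace are singular and orthogonal to the smaller one, so they already
belong to it. -/
theorem IsMaxSingular.eq_of_le {T T' : Submodule F (Idx n → K)}
    (hT : IsMaxSingular (D.form n) ⊤ T) (hT' : IsMaxSingular (D.form n) ⊤ T') (hle : T ≤ T') :
    T = T' :=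
  le_antisymm hle fun x hx =>
    hT.maximal x trivial (hT'.singular x hx) fun _ hy => hT'.add_eq_zero hx (hle hy)

/-! ### The standard representatives of the orbits -/

variable (F K n) in
/-- The standard maximal totally singular subspace with `i`-dimensional core. -/
def std (i : ℕ) : Submodule F (Idx n → K) where
  carrier := {x | ∀ k : Fin n, if (k : ℕ) < i then x (1, k) = 0 else
    (∃ a : F, algebraMap F K a = x (0, k)) ∧ ∃ b : F, algebraMap F K b = x (1, k)}
  add_mem' := by
    intro x y hx hy k
    have h1 := hx k
    have h2 := hy k
    split_ifs at h1 h2 ⊢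
    · rw [Pi.add_apply, h1, h2, add_zero]
    · obtain ⟨⟨a, ha⟩, b, hb⟩ := h1
      obtain ⟨⟨a', ha'⟩, b', hb'⟩ := h2
      exact ⟨⟨a + a', by rw [map_add, ha, ha']; rfl⟩, ⟨b + b', by rw [map_add, hb, hb']; rfl⟩⟩
  zero_mem' := by
    intro k
    split_ifs
    · rfl
    · exact ⟨⟨0, map_zero _⟩, ⟨0, map_zero _⟩⟩
  smul_mem' := by
    intro c x hx k
    have h1 := hx k
    split_ifs at h1 ⊢
    · rw [Pi.smul_apply, h1, smul_zero]
    · obtain ⟨⟨a, ha⟩, b, hb⟩ := h1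
      exact ⟨⟨c * a, by rw [map_mul, ha, Pi.smul_apply, Algebra.smul_def]⟩,
        ⟨c * b, by rw [map_mul, hb, Pi.smul_apply, Algebra.smul_def]⟩⟩

theorem single_mem_std_of_lt {i : ℕ} {k : Fin n} (hk : (k : ℕ) < i) (c : K) :
    Pi.single (0, k) c ∈ std F K n i := by
  intro l
  by_cases hl : l = k
  · subst hl; simp [hk]
  · split_ifs
    · simp
    · exact ⟨⟨0, by simp [hl]⟩, ⟨0, by simp⟩⟩

theorem single_mem_std_of_le {i : ℕ} {k : Fin n} (hk : ¬ (k : ℕ) < i) (a : Fin 2) :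
    Pi.single (a, k) 1 ∈ std F K n i := by
  intro l
  by_cases hl : l = k
  · subst hl
    rw [if_neg hk]
    constructor
    · by_cases ha : a = 0
      · subst ha; exact ⟨1, by simp⟩
      · exact ⟨0, by simp [Ne.symm ha]⟩
    · by_cases ha : a = 1
      · subst ha; exact ⟨1, by simp⟩
      · exact ⟨0, by simp [Ne.symm ha]⟩
  · split_ifs
    · simp [hl]
    · exact ⟨⟨0, by simp [hl]⟩, ⟨0, by simp [hl]⟩⟩

theorem std_isMaxSingular (i : ℕ) : IsMaxSingular (D.form n) ⊤ (std F K n i) where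
  le _ _ := trivial
  singular x hx := by
    rw [form_apply, H_eq_sum, Finset.sum_eq_zero, mul_zero]
    intro k _
    have := hx k
    split_ifs at this
    · simp [this]
    · obtain ⟨⟨a, ha⟩, b, hb⟩ := this
      rw [← ha, ← hb, conj_algebraMap, conj_algebraMap]
      ring
  maximal x _ _ hxy k := by
    have hξ := D.ξ_ne_zero
    have htr : ∀ y ∈ std F K n i, D.form n x y + conj F K (D.form n x y) = 0 := fun y hy => by
      rw [D.form_isHermitian n]; exact hxy y hy
    split_ifs with hk
    · by_contra hne
      -- The scalar is chosen so that the product becomes -w, whose trace is -1 and not 0.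
      have := htr _ (single_mem_std_of_lt hk (conj F K (D.w / (D.ξ * x (1, k)))))
      rw [form_single_zero, D.conj_conj, ← mul_assoc, mul_div_cancel₀ _ (mul_ne_zero hξ hne),
        map_neg, D.conj_w] at this
      have h1 : (1 : K) = 0 := by linear_combination -this
      exact one_ne_zero h1
    · have h0 := (D.add_conj_eq_zero_iff _).1 (htr _ (single_mem_std_of_le hk 1))
      have h1 := (D.add_conj_eq_zero_iff _).1 (htr _ (single_mem_std_of_le hk 0))
      rw [form_single_one, map_one, mul_one] at h0
      rw [form_single_zero, map_one, mul_one] at h1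
      obtain ⟨a, ha⟩ := h0
      obtain ⟨b, hb⟩ := h1
      refine ⟨⟨a, mul_right_cancel₀ hξ (by rw [ha, mul_comm])⟩,
        ⟨-b, mul_right_cancel₀ hξ (by rw [map_neg, neg_mul, hb, neg_neg, mul_comm])⟩⟩

/-- If x ≠ 0 and both x and wx lay in `F`, so would w. It makes the coordinates k ≥ i contribute
nothing to the core of `std`. -/
theorem eq_zero_of_mul_mem (D : QuadExt F K) {x : K}
    (hx : ∀ c : K, ∃ a : F, algebraMap F K a = c * x) : x = 0 := by
  obtain ⟨a, ha⟩ := hx 1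
  obtain ⟨b, hb⟩ := hx D.w
  by_contra hne
  rw [one_mul] at ha
  apply D.smul_one_ne_w (b / a)
  rw [Algebra.smul_def, mul_one, map_div₀, hb, ha, mul_div_cancel_right₀ _ hne]

theorem mem_core_std (D : QuadExt F K) {i : ℕ} {x : Idx n → K} :
    x ∈ core K (std F K n i) ↔ ∀ k : Fin n, x (1, k) = 0 ∧ (i ≤ k → x (0, k) = 0) := by
  constructor
  · intro hx k
    by_cases hk : (k : ℕ) < i
    · have := core_le hx k
      rw [if_pos hk] at this
      exact ⟨this, fun h => absurd hk (by omega)⟩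
    · have hc : ∀ c : K, _ := fun c => by
        have := hx c k
        rw [if_neg hk] at this
        exact this
      exact ⟨D.eq_zero_of_mul_mem fun c => (hc c).2, fun _ => D.eq_zero_of_mul_mem fun c => (hc c).1⟩
  · intro hx c k
    split_ifs with hk
    · rw [Pi.smul_apply, (hx k).1, smul_zero]
    · have e0 : (c • x) (0, k) = 0 := by rw [Pi.smul_apply, (hx k).2 (by omega), smul_zero]
      have e1 : (c • x) (1, k) = 0 := by rw [Pi.smul_apply, (hx k).1, smul_zero]
      rw [e0, e1]
      exact ⟨⟨0, map_zero _⟩, ⟨0, map_zero _⟩⟩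

theorem card_core_std (D : QuadExt F K) {i : ℕ} (hi : i ≤ n) :
    Nat.card (core K (std F K n i)) = Fintype.card F ^ (2 * i) := by
  have := D.finite_ext
  have e : core K (std F K n i) ≃ (Fin i → K) :=
    { toFun := fun x j => x.1 (0, Fin.castLE hi j)
      invFun := fun f => ⟨fun j => if j.1 = 0 then if h : (j.2 : ℕ) < i then f ⟨j.2, h⟩ else 0 else 0,
        (mem_core_std D).2 fun k => ⟨by simp, fun hk => by simp [hk]⟩⟩
      left_inv := by
        rintro ⟨x, hx⟩
        rw [mem_core_std D] at hx
        refine Subtype.ext (funext fun ⟨a, k⟩ => ?_)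
        fin_cases a
        · by_cases hk : (k : ℕ) < i
          · simp [hk]
          · simp [hk, (hx k).2 (by omega)]
        · simp [(hx k).1]
      right_inv := fun f => by
        funext j
        simp }
  rw [Nat.card_congr e, Nat.card_fun, D.card_ext, Nat.card_eq_fintype_card (α := Fin i),
    Fintype.card_fin, ← pow_mul]

theorem mulVec_eq_sum (M : Matrix (Idx n) (Idx n) K) (x : Idx n → K) :
    M *ᵥ x = ∑ k : Fin n, (x (0, k) • (colPairs M k).1 + x (1, k) • (colPairs M k).2) := by
  funext l
  rw [Matrix.mulVec, dotProduct, Fintype.sum_prod_type_right, Finset.sum_apply]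
  refine Finset.sum_congr rfl fun k _ => ?_
  simp [colPairs, Fin.sum_univ_two, mul_comm]

theorem mulVec_single_zero (M : Matrix (Idx n) (Idx n) K) (k : Fin n) (c : K) :
    M *ᵥ Pi.single (0, k) c = c • (colPairs M k).1 := by
  rw [Matrix.mulVec_single]
  funext l
  simp [colPairs, mul_comm]

theorem mulVec_single_one (M : Matrix (Idx n) (Idx n) K) (k : Fin n) (c : K) :
    M *ᵥ Pi.single (1, k) c = c • (colPairs M k).2 := by
  rw [Matrix.mulVec_single]
  funext l
  simp [colPairs, mul_comm]

/-- A unitary matrix maps the standard subspace to `T` if and only if its columns are a frame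
adapted to `T`. -/
theorem moved_std_eq_iff {M : GL (Idx n) K} (hM : M ∈ D.GU n) {i : ℕ}
    {T : Submodule F (Idx n → K)} (hT : IsMaxSingular (D.form n) ⊤ T) :
    moved M (std F K n i) = T ↔
      ∀ k : Fin n, colPairs M.1 k ∈ slots i (⊤ : Submodule K (Idx n → K)) T k := by
  constructor
  · rintro rfl k
    simp only [slots, Set.mem_ofPred_eq]
    split_ifs with hk
    · refine ⟨fun c => ?_, trivial⟩
      rw [← mulVec_single_zero]
      exact mulVec_mem_moved.2 (single_mem_std_of_lt hk c)
    · rw [← one_smul K (colPairs M.1 k).1, ← one_smul K (colPairs M.1 k).2, ← mulVec_single_zero,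
        ← mulVec_single_one]
      exact ⟨mulVec_mem_moved.2 (single_mem_std_of_le hk 0),
        mulVec_mem_moved.2 (single_mem_std_of_le hk 1)⟩
  · intro h
    -- Both subspaces are maximal, so one inclusion is enough.
    refine IsMaxSingular.eq_of_le D ((D.std_isMaxSingular i).moved D hM) hT fun x hx => ?_
    obtain ⟨y, hy, rfl⟩ := mem_moved.1 hx
    rw [mulVec_eq_sum]
    refine T.sum_mem fun k _ => ?_
    have h1 := h k
    have h2 := hy k
    simp only [slots, Set.mem_ofPred_eq] at h1
    split_ifs at h1 h2
    · rw [h2, zero_smul, add_zero]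
      exact h1.1 _
    · obtain ⟨⟨a, ha⟩, b, hb⟩ := h2
      rw [← ha, ← hb, algebraMap_smul_eq, algebraMap_smul_eq]
      exact T.add_mem (T.smul_mem _ h1.1) (T.smul_mem _ h1.2)

/-! ### The orbits of the unitary group -/

variable (n) in
/-- The maximal totally singular `F`-subspaces with `i`-dimensional core. -/
def family (i : ℕ) : Set (Submodule F (Idx n → K)) :=
  {T | IsMaxSingular (D.form n) ⊤ T ∧ Nat.card (core K T) = Fintype.card F ^ (2 * i)}

theorem std_mem_family {i : ℕ} (hi : i ≤ n) : std F K n i ∈ D.family n i :=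
  ⟨D.std_isMaxSingular i, D.card_core_std hi⟩

theorem moved_mem_family {M : GL (Idx n) K} (hM : M ∈ D.GU n) {i : ℕ}
    {T : Submodule F (Idx n → K)} (hT : T ∈ D.family n i) : moved M T ∈ D.family n i :=
  ⟨hT.1.moved D hM, by rw [card_core_moved, hT.2]⟩

/-- The index is the `K`-dimension of the core; its bound by n is part of
`IsMaxSingular.card_adapted`. -/
theorem exists_mem_family {T : Submodule F (Idx n → K)} (hT : IsMaxSingular (D.form n) ⊤ T) :
    ∃ i ≤ n, T ∈ D.family n i := by
  have := D.finite_ext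
  have := D.finite_space n
  have := Module.finite_of_finite K (M := core K T)
  have h := Module.natCard_eq_pow_finrank (K := K) (V := core K T)
  rw [D.card_ext, ← pow_mul] at h
  exact ⟨_, (hT.card_adapted (D.form_isHermitian n) D n _ ⊤ T (D.form_nondegOn_top n)
    (D.card_space n) h).2.1, hT, h⟩

theorem family_index_unique {i j : ℕ} {T : Submodule F (Idx n → K)} (hi : T ∈ D.family n i)
    (hj : T ∈ D.family n j) : i = j := by
  have := Nat.pow_right_injective Fintype.one_lt_card (hi.2.symm.trans hj.2)
  omega

/-- The unitary matrices that map the standard subspace to a given one. -/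
theorem card_transporter {i : ℕ} {T : Submodule F (Idx n → K)} (hT : T ∈ D.family n i) :
    Nat.card {M : D.GU n // moved (M : GL (Idx n) K) (std F K n i) = T} =
      adaptedCount (Fintype.card F) i n := by
  have := D.finite_space n
  rw [← (hT.1.card_adapted (D.form_isHermitian n) D n i ⊤ T (D.form_nondegOn_top n)
    (D.card_space n) hT.2).2.2]
  refine Nat.card_congr (((D.frameEquiv n).subtypeEquiv (q := fun v => ∀ k : Fin n,
    v.1 k ∈ slots i (⊤ : Submodule K (Idx n → K)) T k) fun M => ?_).trans (Equiv.subtypeSubtypeEquivSubtypeInter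
      (fun v => IsFrame D (D.form n) v) (fun v => ∀ k : Fin n, v k ∈ slots i (⊤ : Submodule K (Idx n → K)) T k)))
  rw [D.moved_std_eq_iff M.2 hT.1, frameEquiv_apply]

theorem adaptedCount_pos {q : ℕ} (hq : 1 < q) : ∀ {m i : ℕ}, i ≤ m → 0 < adaptedCount q i m
  | 0, 0, _ => by rw [adaptedCount]; exact one_pos
  | m + 1, 0, _ => by
    rw [adaptedCount]
    have := Nat.one_lt_pow (n := 2 * (m + 1)) (by omega) hq
    have h2 : 0 < q ^ (2 * (m + 1)) - 1 := by omega
    have h3 := adaptedCount_pos hq (Nat.zero_le m)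
    positivity
  | m + 1, i + 1, hi => by
    rw [adaptedCount]
    have := Nat.one_lt_pow (n := 2 * (i + 1)) (by omega) hq
    have h2 : 0 < q ^ (2 * (i + 1)) - 1 := by omega
    have h3 := adaptedCount_pos (m := m) (i := i) hq (by omega)
    positivity

/-- The unitary group is transitive on the maximal totally singular subspaces with
`i`-dimensional core. -/
theorem exists_moved_eq {i : ℕ} (hi : i ≤ n) {T : Submodule F (Idx n → K)}
    (hT : T ∈ D.family n i) : ∃ M ∈ D.GU n, moved M (std F K n i) = T := by
  have h := D.card_transporter hT
  -- A positive number of transporting matrices for every T is transitivity.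
  have hpos := adaptedCount_pos (Fintype.one_lt_card (α := F)) hi
  rw [← h] at hpos
  obtain ⟨⟨M, hM⟩⟩ := (Nat.card_pos_iff.1 hpos).1
  exact ⟨M, M.2, hM⟩

/-- Sort the unitary matrices by the image of `std`: the fibres over the family all have size
`adaptedCount`. -/
theorem card_family_mul {i : ℕ} :
    Nat.card (D.family n i) * adaptedCount (Fintype.card F) i n =
      if i ≤ n then frameCount (Fintype.card F) n else 0 := by
  have := D.finite_space n
  split_ifs with hi
  · have : Fintype (D.family n i) := Fintype.ofFinite _
    rw [← D.card_GU n]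
    have hsig : Nat.card (Σ T : D.family n i,
        {M : D.GU n // moved (M : GL (Idx n) K) (std F K n i) = T.1}) =
        Nat.card (D.family n i) * adaptedCount (Fintype.card F) i n := by
      have := D.finite_ext
      rw [Nat.card_sigma, Finset.sum_congr rfl (fun T _ => D.card_transporter T.2),
        Finset.sum_const, smul_eq_mul, Finset.card_univ, Fintype.card_eq_nat_card]
    rw [← hsig]
    refine Nat.card_congr ⟨fun s => s.2.1, fun M => ⟨⟨moved M.1 (std F K n i),
      D.moved_mem_family M.2 (D.std_mem_family hi)⟩, M, rfl⟩, ?_, fun _ => rfl⟩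
    rintro ⟨⟨T, hT⟩, M, hM⟩
    change moved M.1 (std F K n i) = T at hM
    subst hM
    rfl
  · rw [mul_eq_zero]
    left
    rw [Nat.card_eq_zero]
    left
    exact ⟨fun T => hi (by
      obtain ⟨j, hj, hTj⟩ := D.exists_mem_family T.2.1
      rwa [D.family_index_unique T.2 hTj])⟩

/-- The closed formula for the number of generators in an orbit. -/
theorem frameCount_eq {q : ℕ} (hq : 1 < q) : ∀ {n i : ℕ}, i ≤ n → (frameCount q n : ℚ) =
    (q ^ ((n - i) * (n - i - 1)) *
      ((∏ j ∈ Finset.Icc (n - i + 1) n, ((q : ℚ) ^ (2 * j) - 1)) /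
        ∏ j ∈ Finset.Icc 1 i, ((q : ℚ) ^ (2 * j) - 1)) *
      ∏ j ∈ Finset.Icc 1 n, ((q : ℚ) ^ (2 * j - 1) + 1)) * adaptedCount q i n
  | 0, 0, _ => by simp [frameCount, adaptedCount]
  | n + 1, 0, _ => by
    have ih := frameCount_eq hq (n := n) (Nat.zero_le n)
    have h1 : 1 ≤ q ^ (2 * (n + 1)) := Nat.one_le_pow _ _ (by omega)
    rw [frameCount, adaptedCount, Finset.prod_Icc_succ_top (by omega : 1 ≤ n + 1)]
    push_cast [h1]
    rw [ih]
    simp only [Nat.sub_zero, Nat.lt_add_one, Finset.Icc_eq_empty_of_lt, Finset.prod_empty, div_one,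
      mul_one, show 2 * (n + 1) - 1 = 2 * n + 1 by omega]
    have h2 : (q : ℚ) ^ ((n + 1) * n) = q ^ (n * (n - 1)) * q ^ (2 * n) := by
      rw [← pow_add]
      congr 1
      -- The identity (n + 1)n = n(n - 1) + 2n needs n = 0 apart because of the truncated
      -- subtraction.
      cases n with
      | zero => rfl
      | succ k => rw [Nat.add_sub_cancel]; ring
    rw [h2]
    ring
  | n + 1, i + 1, hi => by
    have ih := frameCount_eq hq (n := n) (i := i) (by omega)
    have h1 : 1 ≤ q ^ (2 * (n + 1)) := Nat.one_le_pow _ _ (by omega)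
    have h2 : 1 ≤ q ^ (2 * (i + 1)) := Nat.one_le_pow _ _ (by omega)
    have h3 : (q : ℚ) ^ (2 * (i + 1)) - 1 ≠ 0 := by
      have : (1 : ℚ) < (q : ℚ) ^ (2 * (i + 1)) := one_lt_pow₀ (by exact_mod_cast hq) (by omega)
      exact sub_ne_zero.2 this.ne'
    rw [frameCount, adaptedCount, Finset.prod_Icc_succ_top (by omega : 1 ≤ n + 1),
      Finset.prod_Icc_succ_top (by omega : 1 ≤ i + 1), Nat.add_sub_add_right,
      Finset.prod_Icc_succ_top (by omega : n - i + 1 ≤ n + 1)]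
    push_cast [h1, h2]
    rw [ih, show 2 * (n + 1) - 1 = 2 * n + 1 by omega, mul_div_mul_comm]
    field_simp

theorem card_family {i : ℕ} (hi : i ≤ n) : ((D.family n i).ncard : ℚ) =
    (Fintype.card F : ℚ) ^ ((n - i) * (n - i - 1)) *
      ((∏ j ∈ Finset.Icc (n - i + 1) n, ((Fintype.card F : ℚ) ^ (2 * j) - 1)) /
        ∏ j ∈ Finset.Icc 1 i, ((Fintype.card F : ℚ) ^ (2 * j) - 1)) *
      ∏ j ∈ Finset.Icc 1 n, ((Fintype.card F : ℚ) ^ (2 * j - 1) + 1) := by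
  have hq := Fintype.one_lt_card (α := F)
  have h := D.card_family_mul (n := n) (i := i)
  rw [if_pos hi] at h
  have hpos : (adaptedCount (Fintype.card F) i n : ℚ) ≠ 0 :=
    Nat.cast_ne_zero.2 (adaptedCount_pos hq hi).ne'
  apply mul_right_cancel₀ hpos
  rw [← frameCount_eq hq hi, ← h, Nat.cast_mul]
  rfl

/-! ### The special unitary group -/

variable (n) in
/-- The maximal totally singular subspaces that arise from the standard one by a unitary matrix
of determinant `d`. -/
def detFamily (d : K) : Set (Submodule F (Idx n → K)) :=
  {T | ∃ M ∈ D.GU n, M.1.det = d ∧ T = moved M (std F K n 0)}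

theorem mem_SU {M : GL (Idx n) K} : M ∈ D.SU n ↔ M ∈ D.GU n ∧ M.1.det = 1 := by
  rw [SU, Subgroup.mem_inf, MonoidHom.mem_ker, Units.ext_iff]
  rfl

/-- A unitary matrix that stabilizes the standard subspace with trivial core has determinant
one. -/
theorem det_eq_one_of_moved_eq {M : GL (Idx n) K} (hM : M ∈ D.GU n)
    (h : moved M (std F K n 0) = std F K n 0) : M.1.det = 1 := by
  refine D.det_eq_one_of_conj_eq n hM fun l ⟨a, k⟩ => ?_
  have h1 := (D.moved_std_eq_iff hM (D.std_isMaxSingular 0)).1 h k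
  simp only [slots, Nat.not_lt_zero, if_false, Set.mem_ofPred_eq] at h1
  -- The columns lie in the standard subspace, whose vectors have all coordinates in `F`; so the
  -- matrix is fixed by conjugation.
  have h2 : (fun l => M.1 l (a, k)) ∈ std F K n 0 := by
    fin_cases a
    · exact h1.1
    · exact h1.2
  have h3 := h2 l.2
  rw [if_neg (Nat.not_lt_zero _)] at h3
  rw [D.conj_eq_self_iff]
  obtain ⟨b, j⟩ := l
  fin_cases b
  · exact h3.1
  · exact h3.2

/-- This makes the determinant an invariant of the subspaces with trivial core, so that the sets
`detFamily` are pairwise disjoint. -/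
theorem det_eq_of_moved_eq {M N : GL (Idx n) K} (hM : M ∈ D.GU n) (hN : N ∈ D.GU n)
    (h : moved M (std F K n 0) = moved N (std F K n 0)) : M.1.det = N.1.det := by
  have h1 : moved (N⁻¹ * M) (std F K n 0) = std F K n 0 := by
    rw [moved_mul, h, ← moved_mul, inv_mul_cancel, moved_one]
  have h2 := D.det_eq_one_of_moved_eq ((D.GU n).mul_mem ((D.GU n).inv_mem hN) hM) h1
  have h3 : M = N * (N⁻¹ * M) := by group
  rw [h3, Units.val_mul, Matrix.det_mul, h2, mul_one]

theorem exists_det (k₀ : Fin n) {d : K} (hd : d * conj F K d = 1) :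
    ∃ M ∈ D.GU n, M.1.det = d := by
  obtain ⟨M, hM, hdet, -⟩ := D.exists_diagonal n hd k₀
  exact ⟨M, hM, hdet⟩

theorem detFamily_injOn (k₀ : Fin n) {d d' : K} (hd : d * conj F K d = 1)
    (h : D.detFamily n d = D.detFamily n d') : d = d' := by
  obtain ⟨M, hM, rfl⟩ := D.exists_det k₀ hd
  have h1 : moved M (std F K n 0) ∈ D.detFamily n d' := h ▸ ⟨M, hM, rfl, rfl⟩
  obtain ⟨N, hN, rfl, he⟩ := h1
  exact D.det_eq_of_moved_eq hM hN he

/-- The unitary group permutes the sets `detFamily` through multiplication by the determinant; hence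
those with d of norm one have equal size. -/
theorem moved_image_detFamily {N : GL (Idx n) K} (hN : N ∈ D.GU n) (d : K) :
    moved N '' D.detFamily n d = D.detFamily n (N.1.det * d) := by
  ext T
  constructor
  · rintro ⟨_, ⟨M, hM, rfl, rfl⟩, rfl⟩
    exact ⟨N * M, (D.GU n).mul_mem hN hM, by rw [Units.val_mul, Matrix.det_mul],
      (moved_mul _ _ _).symm⟩
  · rintro ⟨M, hM, hd, rfl⟩
    refine ⟨_, ⟨N⁻¹ * M, (D.GU n).mul_mem ((D.GU n).inv_mem hN) hM, ?_, rfl⟩, ?_⟩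
    · have h0 : N.1.det ≠ 0 := by
        intro h0
        have := D.det_mul_conj_det n hN
        rw [h0, zero_mul] at this
        exact zero_ne_one this
      apply mul_left_cancel₀ h0
      rw [← hd, ← Matrix.det_mul, ← Units.val_mul, mul_inv_cancel_left]
    · rw [← moved_mul, mul_inv_cancel_left]

theorem ncard_detFamily (k₀ : Fin n) {d : K} (hd : d * conj F K d = 1) :
    (D.detFamily n d).ncard = (D.detFamily n 1).ncard := by
  obtain ⟨N, hN, rfl⟩ := D.exists_det k₀ hd
  have := D.moved_image_detFamily hN 1
  rw [mul_one] at this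
  rw [← this, Set.ncard_image_of_injective _ (moved_injective N)]

/-- The orbits of the special unitary group on the subspaces with trivial core. -/
theorem orbit_SU_eq_detFamily {M : GL (Idx n) K} (hM : M ∈ D.GU n) :
    {T | ∃ N ∈ D.SU n, T = moved N (moved M (std F K n 0))} = D.detFamily n M.1.det := by
  ext T
  constructor
  · rintro ⟨N, hN, rfl⟩
    rw [mem_SU] at hN
    exact ⟨N * M, (D.GU n).mul_mem hN.1 hM, by rw [Units.val_mul, Matrix.det_mul, hN.2, one_mul],
      (moved_mul _ _ _).symm⟩
  · rintro ⟨N, hN, hd, rfl⟩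
    refine ⟨N * M⁻¹, D.mem_SU.2 ⟨(D.GU n).mul_mem hN ((D.GU n).inv_mem hM), ?_⟩, ?_⟩
    · rw [Units.val_mul, Matrix.det_mul, hd, ← Matrix.det_mul, ← Units.val_mul, mul_inv_cancel,
        Units.val_one, Matrix.det_one]
    · rw [← moved_mul, inv_mul_cancel_right]

/-- The special unitary group is transitive on the subspaces with non-trivial core. -/
theorem exists_SU_moved_eq {i : ℕ} (hi1 : 1 ≤ i) (hi : i ≤ n) {T : Submodule F (Idx n → K)}
    (hT : T ∈ D.family n i) : ∃ M ∈ D.SU n, T = moved M (std F K n i) := by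
  obtain ⟨M, hM, rfl⟩ := D.exists_moved_eq hi hT
  have hdet := D.det_mul_conj_det n hM
  have hdet0 : M.1.det ≠ 0 := left_ne_zero_of_mul_eq_one hdet
  have hdet' : (M.1.det)⁻¹ * conj F K (M.1.det)⁻¹ = 1 := by
    rw [map_inv₀, ← mul_inv, hdet, inv_one]
  -- The determinant is corrected on the pair with index 0. As 0 < i, the standard subspace has
  -- there a full `K`-line in the first coordinate and zero in the second, so the diagonal matrix
  -- preserves it.
  obtain ⟨N, hN, hd, a, hNa⟩ := D.exists_diagonal n hdet' ⟨0, by omega⟩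
  have hstab : moved N (std F K n i) = std F K n i := by
    refine IsMaxSingular.eq_of_le D ((D.std_isMaxSingular i).moved D hN) (D.std_isMaxSingular i)
      fun x hx => ?_
    obtain ⟨y, hy, rfl⟩ := mem_moved.1 hx
    intro k
    have hk := hy k
    rw [hNa, Matrix.mulVec_diagonal, Matrix.mulVec_diagonal]
    split_ifs at hk ⊢ with h1
    all_goals simp_all
    all_goals omega
  refine ⟨M * N, D.mem_SU.2 ⟨(D.GU n).mul_mem hM hN, ?_⟩, ?_⟩
  · rw [Units.val_mul, Matrix.det_mul, hd, mul_inv_cancel₀ hdet0]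
  · rw [moved_mul, hstab]

end Action

/-! ### Field reduction of subspaces and projectivities -/

section Reduction

variable {F K : Type*} [Field F] [Fintype F] [Field K] [Algebra F K] (D : QuadExt F K) (n : ℕ)

/-- The isomorphism between the lattices of `F`-subspaces of `V(2n, q²)` and `V(4n, q)`. -/
def red : Submodule F (Idx n → K) ≃o Submodule F (V F n) :=
  Submodule.orderIsoMapComap (D.φ n)

theorem φ_mem_red {T : Submodule F (Idx n → K)} {x : Idx n → K} :
    D.φ n x ∈ D.red n T ↔ x ∈ T := by
  change D.φ n x ∈ T.map (D.φ n : (Idx n → K) →ₗ[F] V F n) ↔ _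
  simp

theorem reduce_eq_red (U : Submodule K (Idx n → K)) :
    D.reduce n U = D.red n (U.restrictScalars F) := rfl

theorem projectivity_red (M : GL (Idx n) K) (T : Submodule F (Idx n → K)) :
    projectivityHom F (V F n) (D.bar n M) (D.red n T) = D.red n (moved M T) := by
  ext v
  obtain ⟨x, rfl⟩ := (D.φ n).surjective v
  obtain ⟨y, rfl⟩ := exists_mulVec_eq M x
  rw [φ_mem_red, mulVec_mem_moved, ← bar_φ]
  change D.bar n M (D.φ n y) ∈ (D.red n T).map (D.bar n M : V F n →ₗ[F] V F n) ↔ _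
  rw [Submodule.mem_map]
  simp [φ_mem_red]

theorem isTotallySingular_red {T : Submodule F (Idx n → K)} :
    IsTotallySingular (D.Q n) (D.red n T) ↔ ∀ x ∈ T, D.form n x x = 0 := by
  have h0 : ∀ x, D.Q n (D.φ n x) = 0 ↔ D.form n x x = 0 := fun x => by
    rw [form_apply, ← Q_φ, map_eq_zero (algebraMap F K)]
  constructor
  · intro h x hx
    exact (h0 x).1 (h _ ((D.φ_mem_red n).2 hx))
  · intro h v hv
    obtain ⟨x, rfl⟩ := (D.φ n).surjective v
    exact (h0 x).2 (h x ((D.φ_mem_red n).1 hv))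

/-- Maximality in the lattice matches maximality vector by vector: a singular x orthogonal to T can
be adjoined to T, and a vector of a larger totally singular subspace is orthogonal to T. -/
theorem red_mem_generators {T : Submodule F (Idx n → K)} :
    D.red n T ∈ generators (D.Q n) ↔ IsMaxSingular (D.form n) ⊤ T := by
  constructor
  · rintro ⟨h1, h2⟩
    rw [isTotallySingular_red] at h1
    refine ⟨fun _ _ => trivial, h1, fun x _ hxx hxy => ?_⟩
    have h3 : IsTotallySingular (D.Q n) (D.red n (T ⊔ Submodule.span F {x})) := by
      rw [isTotallySingular_red]
      intro z hz
      obtain ⟨y, hy, z', hz', rfl⟩ := Submodule.mem_sup.1 hz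
      obtain ⟨a, rfl⟩ := Submodule.mem_span_singleton.1 hz'
      rw [← algebraMap_smul_eq (K := K)]
      simp only [map_add, LinearMap.add_apply, map_smul, LinearMap.smul_apply, smul_eq_mul,
        LinearMap.map_smulₛₗ, conj_algebraMap, h1 y hy, hxx]
      linear_combination algebraMap F K a * hxy y hy
    have h4 := h2 h3 ((D.red n).le_iff_le.2 le_sup_left)
    rw [(D.red n).le_iff_le] at h4
    exact h4 (Submodule.mem_sup_right (Submodule.mem_span_singleton_self x))
  · intro hT
    refine ⟨(D.isTotallySingular_red n).2 hT.singular, fun W hW hle => ?_⟩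
    obtain ⟨T', rfl⟩ := (D.red n).surjective W
    rw [isTotallySingular_red] at hW
    rw [(D.red n).le_iff_le] at hle ⊢
    refine fun x hx => hT.maximal x trivial (hW x hx) fun y hy => ?_
    have := hW _ (T'.add_mem hx (hle hy))
    simpa [hW x hx, hW y (hle hy), add_comm] using this

/-- The orbit of a subspace under the projectivities induced by a group of matrices. -/
theorem orbit_red (S : Subgroup (GL (Idx n) K)) (T : Submodule F (Idx n → K)) :
    MulAction.orbit (S.map ((projectivityHom F (V F n)).comp (D.bar n))) (D.red n T) =
      D.red n '' {T' | ∃ M ∈ S, T' = moved M T} := by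
  ext W
  constructor
  · rintro ⟨⟨_, M, hM, rfl⟩, rfl⟩
    exact ⟨_, ⟨M, hM, rfl⟩, (D.projectivity_red n M T).symm⟩
  · rintro ⟨_, ⟨M, hM, rfl⟩, rfl⟩
    exact ⟨⟨_, M, hM, rfl⟩, D.projectivity_red n M T⟩

theorem G_le_projectiveOrthogonalGroup : D.G n ≤ projectiveOrthogonalGroup (D.Q n) := by
  rintro _ ⟨M, hM, rfl⟩
  refine ⟨⟨_, rfl⟩, ?_⟩
  refine MulAction.mem_stabilizer_set.2 ?_
  intro P
  change projectivityHom F (V F n) (D.bar n M) P ∈ _ ↔ _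
  refine and_congr ?_ ?_
  · rw [show Module.finrank F (projectivityHom F (V F n) (D.bar n M) P) = Module.finrank F P from
      (D.bar n M).finrank_map_eq P]
  · obtain ⟨T, rfl⟩ := (D.red n).surjective P
    rw [projectivity_red, isTotallySingular_red, isTotallySingular_red]
    constructor
    · intro h x hx
      rw [← D.form_mulVec n hM]
      exact h _ (mulVec_mem_moved.2 hx)
    · intro h x hx
      obtain ⟨y, hy, rfl⟩ := mem_moved.1 hx
      rw [D.form_mulVec n hM, h y hy]

/-- A unitary matrix that induces the identity is `±1`. -/
theorem eq_one_or_neg_one (hn : 1 ≤ n) {M : GL (Idx n) K} (hM : M ∈ D.GU n)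
    (h : projectivityHom F (V F n) (D.bar n M) = 1) : M = 1 ∨ M = -1 := by
  have hfix : ∀ T : Submodule F (Idx n → K), moved M T = T := fun T => by
    apply (D.red n).injective
    rw [← projectivity_red, h]
    rfl
  -- All points of PG(4n-1, q) are fixed, so every vector is an eigenvector over `F` and the map is
  -- a scalar a in `F`. Invariance of the form on one hyperbolic pair then gives a² = 1.
  obtain ⟨a, ha⟩ := LinearMap.exists_eq_smul_id_of_forall_notLinearIndependent
    (f := (act F M : (Idx n → K) →ₗ[F] (Idx n → K))) (fun x => by
      have hx : M.1 *ᵥ x ∈ Submodule.span F {x} := by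
        rw [← hfix (Submodule.span F {x})]
        exact mulVec_mem_moved.2 (Submodule.mem_span_singleton_self x)
      obtain ⟨c, hc⟩ := Submodule.mem_span_singleton.1 hx
      intro hli
      rw [LinearIndependent.pair_iff] at hli
      have := hli (-c) 1 (by
        rw [LinearEquiv.coe_coe, act_apply, ← hc, one_smul, neg_smul, neg_add_cancel])
      exact one_ne_zero this.2)
  have haM : ∀ x : Idx n → K, M.1 *ᵥ x = algebraMap F K a • x := fun x => by
    have := LinearMap.congr_fun ha x
    rwa [LinearEquiv.coe_coe, act_apply, LinearMap.smul_apply, Module.End.one_apply,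
      ← algebraMap_smul_eq (K := K)] at this
  have hM1 : M.1 = algebraMap F K a • (1 : Matrix (Idx n) (Idx n) K) := by
    apply Matrix.ext_of_mulVec_single
    intro i
    rw [haM, Matrix.smul_mulVec, Matrix.one_mulVec]
  have hξ := D.ξ_ne_zero
  have hsq : algebraMap F K a ^ 2 = 1 := by
    have h1 := D.form_mulVec n hM (Pi.single (0, ⟨0, hn⟩) 1) (Pi.single (1, ⟨0, hn⟩) 1)
    rw [haM, haM, (D.form n).map_smul, LinearMap.smul_apply, LinearMap.map_smulₛₗ,
      conj_algebraMap, form_single_one] at h1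
    simp only [Pi.single_eq_same, map_one, mul_one, smul_eq_mul] at h1
    apply mul_right_cancel₀ hξ
    linear_combination h1
  rcases mul_self_eq_one_iff.1 ((pow_two _).symm.trans hsq) with h1 | h1
  · left
    exact Units.ext (by rw [hM1, h1, one_smul]; rfl)
  · right
    exact Units.ext (by rw [hM1, h1, neg_one_smul]; rfl)

theorem projectivity_neg_one : projectivityHom F (V F n) (D.bar n (-1)) = 1 := by
  apply RelIso.ext
  intro W
  obtain ⟨T, rfl⟩ := (D.red n).surjective W
  rw [projectivity_red]
  change D.red n (moved (-1) T) = D.red n T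
  congr 1
  ext x
  rw [mem_moved]
  constructor
  · rintro ⟨y, hy, rfl⟩
    rw [Units.val_neg, Units.val_one, Matrix.neg_mulVec, Matrix.one_mulVec]
    exact T.neg_mem hy
  · intro hx
    exact ⟨-x, T.neg_mem hx, by
      rw [Units.val_neg, Units.val_one, Matrix.neg_mulVec, Matrix.one_mulVec, neg_neg]⟩

/-- `G_n` is isomorphic to `GU(2n, q) / ⟨-I⟩`. -/
theorem nonempty_quotient_mulEquiv (hn : 1 ≤ n) :
    Nonempty ((D.GU n ⧸ D.negOneSubgroup n) ≃* D.G n) := by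
  let f : D.GU n →* (Submodule F (V F n) ≃o Submodule F (V F n)) :=
    ((projectivityHom F (V F n)).comp (D.bar n)).comp (D.GU n).subtype
  have hker : D.negOneSubgroup n = f.ker := by
    ext M
    rw [negOneSubgroup, Subgroup.mem_subgroupOf, MonoidHom.mem_ker]
    constructor
    · intro hM
      have hle : Subgroup.zpowers (-1 : GL (Idx n) K) ≤
          ((projectivityHom F (V F n)).comp (D.bar n)).ker := by
        rw [Subgroup.zpowers_le, MonoidHom.mem_ker]
        exact D.projectivity_neg_one n
      exact hle hM
    · intro hM
      rcases D.eq_one_or_neg_one n hn M.2 hM with h | h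
      · rw [h]; exact Subgroup.one_mem _
      · rw [h]; exact Subgroup.mem_zpowers _
  have hrange : f.range = D.G n := by
    rw [G, MonoidHom.range_comp, Subgroup.range_subtype]
  exact ⟨(QuotientGroup.quotientMulEquivOfEq hker).trans
    ((QuotientGroup.quotientKerEquivRange f).trans (MulEquiv.subgroupCongr hrange))⟩

/-! ### Lines of the Desarguesian spread -/

theorem reduce_span_le_red {T : Submodule F (Idx n → K)} {x : Idx n → K} :
    D.reduce n (Submodule.span K {x}) ≤ D.red n T ↔ x ∈ core K T := by
  rw [reduce_eq_red, (D.red n).le_iff_le]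
  constructor
  · intro h c
    exact h (Submodule.smul_mem _ c (Submodule.mem_span_singleton_self x))
  · intro h z hz
    obtain ⟨c, rfl⟩ := Submodule.mem_span_singleton.1 ((Submodule.restrictScalars_mem F _ _).1 hz)
    exact h c

/-- A line of the spread lies in the generator exactly when its `K`-point lies in the core, and all
vectors of the core are isotropic. The count is thus that of the points of a projective space over
`K`. -/
theorem card_lines {i : ℕ} {T : Submodule F (Idx n → K)} (hT : T ∈ D.family n i) :
    ({l | l ∈ D.L₁ n ∧ l ≤ D.red n T}.ncard : ℚ) =
      ((Fintype.card F : ℚ) ^ (2 * i) - 1) / ((Fintype.card F : ℚ) ^ 2 - 1) := by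
  have hq := Fintype.one_lt_card (α := F)
  have := D.finite_ext
  have := D.finite_space n
  let f : Projectivization K (core K T) → Submodule F (V F n) :=
    fun P => D.reduce n (P.submodule.map (core K T).subtype)
  have hf : Function.Injective f := by
    intro P P' h
    simp only [f, reduce_eq_red] at h
    have h1 := (Submodule.restrictScalars_injective F K _) ((D.red n).injective h)
    exact Projectivization.submodule_injective
      (Submodule.map_injective_of_injective (core K T).subtype_injective h1)
  have hmk : ∀ (x : core K T) (hx : x ≠ 0),
      f (Projectivization.mk K x hx) = D.reduce n (Submodule.span K {(x : Idx n → K)}) := by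
    intro x hx
    simp only [f, Projectivization.submodule_mk, Submodule.map_span, Set.image_singleton]
    rfl
  have hrange : {l | l ∈ D.L₁ n ∧ l ≤ D.red n T} = Set.range f := by
    ext l
    constructor
    · rintro ⟨⟨x, hx0, hxx, rfl⟩, hle⟩
      rw [reduce_span_le_red] at hle
      exact ⟨Projectivization.mk K (⟨x, hle⟩ : core K T) (fun h => hx0 (congrArg Subtype.val h)),
        hmk _ _⟩
    · rintro ⟨P, rfl⟩
      induction P using Projectivization.ind with
      | h x hx =>
        rw [hmk]
        refine ⟨⟨x, fun h => hx (Subtype.ext h), hT.1.singular _ (core_le x.2), rfl⟩, ?_⟩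
        rw [reduce_span_le_red]
        exact x.2
  have hc := Projectivization.card' K (core K T)
  rw [hT.2, D.card_ext] at hc
  have h1 : 1 ≤ Fintype.card F ^ 2 := Nat.one_le_pow _ _ (by omega)
  have hc' := congrArg (Nat.cast : ℕ → ℚ) hc
  push_cast [h1] at hc'
  have h2 : (1 : ℚ) < (Fintype.card F : ℚ) ^ 2 := one_lt_pow₀ (by exact_mod_cast hq) (by omega)
  rw [hrange, ← Nat.card_coe_set_eq, Nat.card_range_of_injective hf, hc',
    add_sub_cancel_right, mul_div_cancel_right₀ _ (sub_ne_zero.2 h2.ne')]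

end Reduction

/-! ### The orbits on generators -/

section Orbits

variable {F K : Type*} [Field F] [Fintype F] [Field K] [Algebra F K] (D : QuadExt F K) (n : ℕ)

/-- The generators that correspond to the subspaces with `i`-dimensional core. -/
def generatorFamily (i : ℕ) : Set (Submodule F (V F n)) := D.red n '' D.family n i

theorem generatorFamily_subset (i : ℕ) : D.generatorFamily n i ⊆ generators (D.Q n) := by
  rintro _ ⟨T, hT, rfl⟩
  exact (D.red_mem_generators n).2 hT.1

theorem orbit_G_eq {i : ℕ} (hi : i ≤ n) {W : Submodule F (V F n)} (hW : W ∈ D.generatorFamily n i) :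
    MulAction.orbit (D.G n) W = D.generatorFamily n i := by
  obtain ⟨T, hT, rfl⟩ := hW
  rw [G, orbit_red, generatorFamily]
  congr 1
  ext T'
  constructor
  · rintro ⟨M, hM, rfl⟩
    exact D.moved_mem_family hM hT
  · intro hT'
    obtain ⟨M, hM, rfl⟩ := D.exists_moved_eq hi hT
    obtain ⟨N, hN, rfl⟩ := D.exists_moved_eq hi hT'
    exact ⟨N * M⁻¹, (D.GU n).mul_mem hN ((D.GU n).inv_mem hM), by
      rw [← moved_mul, inv_mul_cancel_right]⟩

theorem red_std_mem {i : ℕ} (hi : i ≤ n) : D.red n (std F K n i) ∈ D.generatorFamily n i :=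
  ⟨_, D.std_mem_family hi, rfl⟩

theorem generatorFamily_injective :
    Function.Injective fun i : Fin (n + 1) => D.generatorFamily n i := by
  intro i j h
  have h1 := D.red_std_mem n (Nat.lt_succ_iff.1 i.2)
  change D.generatorFamily n i = D.generatorFamily n j at h
  rw [h] at h1
  obtain ⟨T, hT, he⟩ := h1
  have he' := (D.red n).injective he
  subst he'
  exact Fin.ext (D.family_index_unique (D.std_mem_family (Nat.lt_succ_iff.1 i.2)) hT)

theorem range_generatorFamily : Set.range (fun i : Fin (n + 1) => D.generatorFamily n i) =
    orbitsOn (D.G n) (generators (D.Q n)) := by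
  ext S
  constructor
  · rintro ⟨i, rfl⟩
    have hi := Nat.lt_succ_iff.1 i.2
    exact ⟨_, D.generatorFamily_subset n i (D.red_std_mem n hi),
      D.orbit_G_eq n hi (D.red_std_mem n hi)⟩
  · rintro ⟨W, hW, rfl⟩
    obtain ⟨T, rfl⟩ := (D.red n).surjective W
    obtain ⟨i, hi, hT⟩ := D.exists_mem_family ((D.red_mem_generators n).1 hW)
    exact ⟨⟨i, by omega⟩, (D.orbit_G_eq n hi ⟨T, hT, rfl⟩).symm⟩

theorem ncard_generatorFamily (i : ℕ) : (D.generatorFamily n i).ncard = (D.family n i).ncard :=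
  Set.ncard_image_of_injective _ (D.red n).injective

theorem orbit_Kgrp_eq {i : ℕ} (hi1 : 1 ≤ i) (hi : i ≤ n) :
    MulAction.orbit (D.Kgrp n) (D.red n (std F K n i)) = D.generatorFamily n i := by
  rw [Kgrp, orbit_red, generatorFamily]
  congr 1
  ext T
  constructor
  · rintro ⟨M, hM, rfl⟩
    exact D.moved_mem_family (D.mem_SU.1 hM).1 (D.std_mem_family hi)
  · exact D.exists_SU_moved_eq hi1 hi

/-- The orbits are labelled by the determinants of unitary matrices, which are exactly the elements
of norm one since n ≥ 1. -/
theorem orbitsOn_Kgrp_zero (hn : 1 ≤ n) : orbitsOn (D.Kgrp n) (D.generatorFamily n 0) =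
    (fun d : K => D.red n '' D.detFamily n d) '' {d | d * conj F K d = 1} := by
  ext S
  constructor
  · rintro ⟨_, ⟨T, hT, rfl⟩, rfl⟩
    obtain ⟨M, hM, rfl⟩ := D.exists_moved_eq (Nat.zero_le n) hT
    refine ⟨M.1.det, D.det_mul_conj_det n hM, ?_⟩
    exact ((D.orbit_red n (D.SU n) _).trans (by rw [D.orbit_SU_eq_detFamily hM])).symm
  · rintro ⟨d, hd, rfl⟩
    obtain ⟨M, hM, rfl⟩ := D.exists_det ⟨0, hn⟩ hd
    refine ⟨_, ⟨_, D.moved_mem_family hM (D.std_mem_family (Nat.zero_le n)), rfl⟩, ?_⟩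
    exact (D.orbit_red n (D.SU n) _).trans (by rw [D.orbit_SU_eq_detFamily hM])

theorem detFamily_subset (d : K) : D.red n '' D.detFamily n d ⊆ D.generatorFamily n 0 := by
  rintro _ ⟨_, ⟨M, hM, -, rfl⟩, rfl⟩
  exact ⟨_, D.moved_mem_family hM (D.std_mem_family (Nat.zero_le n)), rfl⟩

theorem ncard_orbitsOn_Kgrp_zero (hn : 1 ≤ n) :
    (orbitsOn (D.Kgrp n) (D.generatorFamily n 0)).ncard = Fintype.card F + 1 := by
  rw [D.orbitsOn_Kgrp_zero n hn, Set.InjOn.ncard_image, ← D.card_norm_one]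
  · rfl
  · intro d hd d' _ h
    exact D.detFamily_injOn ⟨0, hn⟩ hd (((D.red n).injective.image_injective) h)

end Orbits

end QuadExt

end FieldReduction

end

/-! ### Assembly of the orbit theorem. -/

open FieldReduction in
theorem mainTheorem9 {F K : Type*} [Field F] [Fintype F] [Field K] [Algebra F K]
    (D : QuadExt F K) (n : ℕ) (hn : 1 ≤ n) (q : ℕ) (hq : Fintype.card F = q) :
    -- `G_n` is a subgroup of `PGO⁺(4n, q)` isomorphic to `GU(2n, q) / ⟨-I⟩`
    D.G n ≤ projectiveOrthogonalGroup (D.Q n) ∧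
    Nonempty ((D.GU n ⧸ D.negOneSubgroup n) ≃* D.G n) ∧
    ∃ O : Fin (n + 1) → Set (Submodule F (QuadExt.V F n)),
      -- the sets `O i` are the `n + 1` distinct orbits of `G_n` on generators
      Function.Injective O ∧
      Set.range O = orbitsOn (D.G n) (generators (D.Q n)) ∧
      (∀ i, O i ⊆ generators (D.Q n)) ∧
      -- their sizes
      ((O 0).ncard : ℚ) = q ^ (n ^ 2 - n) * ∏ j ∈ Finset.Icc 1 n, ((q : ℚ) ^ (2 * j - 1) + 1) ∧
      ((O (Fin.last n)).ncard : ℚ) = ∏ j ∈ Finset.Icc 1 n, ((q : ℚ) ^ (2 * j - 1) + 1) ∧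
      (∀ i : Fin (n + 1), 1 ≤ (i : ℕ) → (i : ℕ) ≤ n - 1 →
        ((O i).ncard : ℚ) = q ^ ((n - i) * (n - i - 1)) *
          ((∏ j ∈ Finset.Icc (n - i + 1) n, ((q : ℚ) ^ (2 * j) - 1)) /
            ∏ j ∈ Finset.Icc 1 (i : ℕ), ((q : ℚ) ^ (2 * j) - 1)) *
          ∏ j ∈ Finset.Icc 1 n, ((q : ℚ) ^ (2 * j - 1) + 1)) ∧
      -- the number of lines of the Desarguesian line-spread in a member of `O i`
      (∀ i : Fin (n + 1), ∀ W ∈ O i,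
        ({l | l ∈ D.L₁ n ∧ l ≤ W}.ncard : ℚ) =
          ((q : ℚ) ^ (2 * (i : ℕ)) - 1) / ((q : ℚ) ^ 2 - 1)) ∧
      -- for `i ≥ 1`, `O i` is an orbit of `K_n`
      (∀ i : Fin (n + 1), 1 ≤ (i : ℕ) → O i ∈ orbitsOn (D.Kgrp n) (generators (D.Q n))) ∧
      -- `O 0` splits into `q + 1` orbits of `K_n`, all of the same size
      (∀ S ∈ orbitsOn (D.Kgrp n) (O 0), S ⊆ O 0) ∧
      (orbitsOn (D.Kgrp n) (O 0)).ncard = q + 1 ∧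
      (∀ S ∈ orbitsOn (D.Kgrp n) (O 0), ∀ T ∈ orbitsOn (D.Kgrp n) (O 0),
        S.ncard = T.ncard) := by
  subst hq
  refine ⟨D.G_le_projectiveOrthogonalGroup n, D.nonempty_quotient_mulEquiv n hn,
    fun i => D.generatorFamily n i, D.generatorFamily_injective n, D.range_generatorFamily n,
    fun i => D.generatorFamily_subset n i, ?_, ?_, ?_, ?_, ?_, ?_, ?_, ?_⟩
  · rw [D.ncard_generatorFamily, Fin.val_zero, D.card_family (Nat.zero_le n)]
    simp [Nat.mul_sub, pow_two]
  -- For i = n the two products in the quotient coincide, and they are non-zero because q > 1.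
  · rw [D.ncard_generatorFamily, Fin.val_last, D.card_family le_rfl, Nat.sub_self, Nat.zero_mul,
      pow_zero, one_mul, Nat.zero_add, div_self, one_mul]
    refine Finset.prod_ne_zero_iff.2 fun j hj => sub_ne_zero.2 (ne_of_gt ?_)
    exact one_lt_pow₀ (by exact_mod_cast Fintype.one_lt_card)
      (by have := (Finset.mem_Icc.1 hj).1; omega)
  · intro i _ _
    rw [D.ncard_generatorFamily, D.card_family (Nat.lt_succ_iff.1 i.2)]
  · rintro i _ ⟨T, hT, rfl⟩
    exact D.card_lines n hT
  · intro i hi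
    have hin := Nat.lt_succ_iff.1 i.2
    exact ⟨_, D.generatorFamily_subset n i (D.red_std_mem n hin), D.orbit_Kgrp_eq n hi hin⟩
  · intro S hS
    change S ∈ orbitsOn (D.Kgrp n) (D.generatorFamily n 0) at hS
    rw [D.orbitsOn_Kgrp_zero n hn] at hS
    obtain ⟨d, -, rfl⟩ := hS
    exact D.detFamily_subset n d
  · exact D.ncard_orbitsOn_Kgrp_zero n hn
  · intro S hS T hT
    change S ∈ orbitsOn (D.Kgrp n) (D.generatorFamily n 0) at hS
    change T ∈ orbitsOn (D.Kgrp n) (D.generatorFamily n 0) at hT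
    rw [D.orbitsOn_Kgrp_zero n hn] at hS hT
    obtain ⟨d, hd, rfl⟩ := hS
    obtain ⟨d', hd', rfl⟩ := hT
    simp only [Set.ncard_image_of_injective _ (D.red n).injective]
    rw [D.ncard_detFamily ⟨0, hn⟩ hd, D.ncard_detFamily ⟨0, hn⟩ hd']
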